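/- Let $1\le K\le M$, let $\boldsymbol x\sim\mathcal{CN}(\boldsymbol 0,\boldsymbol I_K)$, $\boldsymbol n\sim\mathcal{CN}(\boldsymbol 0,\sigma^2\boldsymbol I_M)$ with $\sigma^2>0$, and let $\boldsymbol H\in\mathbb C^{M\times K}$ have i.i.d. $\mathcal{CN}(0,1)$ entries, all independent. Put $\boldsymbol y=\boldsymbol H\boldsymbol x+\boldsymbol n$, $\tilde{\boldsymbol x}=(\boldsymbol H^H\boldsymbol H)^{-1}\boldsymbol H^H\boldsymbol y$, $\boldsymbol A=\sigma^2(\boldsymbol H^H\boldsymbol H)^{-1}$, and let $a_1,\dots,a_K$ be the diagonal entries of $\boldsymbol A$. Fix quantization points $0<b_1\le\dots\le b_{J-1}<b_J=+\infty$, let $\lceil a\rceil$ be the least $b_j$ with $a\le b_j$, and let $\boldsymbol A_1'=\mathrm{diag}\{\lceil a_1\rceil,\dots,\lceil a_K\rceil\}$. Let $\hat{\boldsymbol x}=\tilde{\boldsymbol x}+\tilde{\boldsymbol n}'$ be the degraded zero-forcing estimate, where, given $(\boldsymbol x,\boldsymbol n,\boldsymbol H)$, $\tilde{\boldsymbol n}'\sim\mathcal{CN}(\boldsymbol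 0,\mathrm{diag}\{\lceil a_k\rceil-a_k\}_k)$, and let $\hat{\boldsymbol x}_g=\boldsymbol x+\hat{\boldsymbol n}_g$, where, given everything else, $\hat{\boldsymbol n}_g\sim\mathcal{CN}(\boldsymbol 0,\boldsymbol A_1')$; in both vectors a component with $\lceil a_k\rceil=+\infty$ carries no signal and is erased (set to $0$). Let $\boldsymbol\Phi$ be a diagonal matrix with non-negative real diagonal entries, which may depend on $\boldsymbol A_1'$, and set $$\boldsymbol z=\boldsymbol\Phi\hat{\boldsymbol x}+\hat{\boldsymbol n}_g',\qquad \hat{\boldsymbol z}_g=\boldsymbol\Phi\hat{\boldsymbol x}_g+\hat{\boldsymbol n}_g',$$ where $\hat{\boldsymbol n}_g'\sim\mathcal{CN}(\boldsymbol 0,\boldsymbol I_K)$ is independent of everything else. Logarithms and mutual informations are to base $2$. Then $$I(\hat{\boldsymbol x};\boldsymbol z\mid\boldsymbol A_1')\le I(\hat{\boldsymbol x}_g;\hat{\boldsymbol z}_g\mid\boldsymbol A_1'),\qquad I(\boldsymbol x;\boldsymbol z\mid\boldsymbol A_1')\ge I(\boldsymbol x;\hat{\boldsymbol z}_g\mid\boldsymbol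 A_1').$$ Moreover, let $P_j=\Pr\{b_{j-1}<a_k\le b_j\}$ (with $b_0=0$; this does not depend on $k$), $H_0=-\sum_{j=1}^J P_j\log P_j$, $\rho_j=1/b_j$, $c_j=[\log(\rho_j/\nu)]^+$, where $C\in\mathbb R$ and $\nu>0$ satisfy $\sum_{j=1}^{J-1}KP_jc_j=C-KH_0$, and $$R^{\mathrm{lb}2}=\sum_{j=1}^{J-1}KP_j\left[\log(1+\rho_j)-\log(1+\rho_j2^{-c_j})\right].$$ Call $\boldsymbol\Phi$ optimal if it maximizes $I(\boldsymbol x;\hat{\boldsymbol z}_g\mid\boldsymbol A_1')$ among all $\boldsymbol\Phi$ as above that satisfy $I(\hat{\boldsymbol x}_g;\hat{\boldsymbol z}_g\mid\boldsymbol A_1')\le C-KH_0$. Then an optimal $\boldsymbol\Phi$ exists, and for every optimal $\boldsymbol\Phi$ $$I(\hat{\boldsymbol x};\boldsymbol z\mid\boldsymbol A_1')\le I(\hat{\boldsymbol x}_g;\hat{\boldsymbol z}_g\mid\boldsymbol A_1')\le C-KH_0,\qquad I(\boldsymbol x;\boldsymbol z\mid\boldsymbol A_1')\ge I(\boldsymbol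 x;\hat{\boldsymbol z}_g\mid\boldsymbol A_1')=R^{\mathrm{lb}2}.$$ -/

import Mathlib

open MeasureTheory ProbabilityTheory
open scoped ENNReal NNReal

namespace QCI

noncomputable section

/-! ### Mutual information, in bits -/

section Information

variable {Ω α β γ : Type*} [MeasurableSpace Ω] [MeasurableSpace α] [MeasurableSpace β]

/-- The mutual information `I(X; Y)` in bits: the Kullback-Leibler divergence of the joint law of
`X` and `Y` from the product of their laws. -/
def mutualInfo (X : Ω → α) (Y : Ω → β) (μ : Measure Ω) : ℝ≥0∞ :=
  InformationTheory.klDiv (μ.map fun ω => (X ω, Y ω)) ((μ.map X).prod (μ.map Y)) /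
    ENNReal.ofReal (Real.log 2)

/-- The conditional mutual information `I(X; Y | W)` in bits, for a random variable `W` that takes
finitely (or countably) many values `w`: the average of `I(X; Y | W = w)`. -/
def condMutualInfo (X : Ω → α) (Y : Ω → β) (W : Ω → γ) (μ : Measure Ω) : ℝ≥0∞ :=
  ∑' w : γ, μ (W ⁻¹' {w}) * mutualInfo X Y (cond μ (W ⁻¹' {w}))

end Information

/-! ### Complex Gaussian vectors -/

/-- The circularly symmetric complex Gaussian law `CN(0, s)` on `ℂ`: real and imaginary parts are
independent, each with law `N(0, s / 2)`. -/
def complexGaussian (s : ℝ≥0) : Measure ℂ :=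
  ((gaussianReal 0 (s / 2)).prod (gaussianReal 0 (s / 2))).map fun p => (⟨p.1, p.2⟩ : ℂ)

/-- The law `CN(0, s I)` on `ℂ^d`. -/
def complexGaussianVec (d : ℕ) (s : ℝ≥0) : Measure (Fin d → ℂ) :=
  Measure.pi fun _ => complexGaussian s

/-- The law of an `M × K` matrix whose entries are i.i.d. `CN(0, 1)`. -/
def rayleigh (M K : ℕ) : Measure (Fin M → Fin K → ℂ) :=
  Measure.pi fun _ => complexGaussianVec K 1

/-! ### The quantizer of the noise levels -/

/-- The ceiling of `a` in the grid `b`: the least grid point that is at least `a`. -/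
def ceilGrid {J : ℕ} (b : Fin J → ℝ≥0∞) (a : ℝ) : ℝ≥0∞ :=
  ⨅ (j : Fin J) (_ : ENNReal.ofReal a ≤ b j), b j

/-- The `j`-th quantization cell `(b_{j-1}, b_j]`, i.e. the numbers that are rounded up
to `b_j`. -/
def cell {J : ℕ} (b : Fin J → ℝ≥0∞) (j : Fin J) : Set ℝ :=
  {a | (∀ i < j, b i < ENNReal.ofReal a) ∧ ENNReal.ofReal a ≤ b j}

/-! ### The scheme -/

/-- The random variables of the quantized channel inversion scheme with `K` inputs, `M` relay
antennas and `J = m + 1` quantization points, on the probability space `(Ω, μ)`. -/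
structure Scheme {Ω : Type*} [MeasurableSpace Ω] (μ : Measure Ω) (M K m : ℕ) where
  /-- The variance `σ²` of the channel noise. -/
  noiseVar : ℝ≥0
  noiseVar_pos : 0 < noiseVar
  /-- The quantization points `b_1 ≤ ⋯ ≤ b_{J-1} < b_J = ∞`. -/
  b : Fin (m + 1) → ℝ≥0∞
  b_mono : Monotone b
  b_pos : ∀ j, 0 < b j
  b_eq_top_iff : ∀ j, b j = ∞ ↔ j = Fin.last m
  /-- The channel input, with law `CN(0, I_K)`. -/
  x : Ω → Fin K → ℂ
  /-- The channel noise, with law `CN(0, σ² I_M)`. -/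
  n : Ω → Fin M → ℂ
  /-- The channel matrix, with i.i.d. `CN(0, 1)` entries. -/
  H : Ω → Fin M → Fin K → ℂ
  /-- Independent `CN(0, I_K)` noise, which is scaled to give the artificial noise `ñ'`. -/
  w : Ω → Fin K → ℂ
  /-- Independent `CN(0, I_K)` noise, which is scaled to give the noise `n̂_g`. -/
  v : Ω → Fin K → ℂ
  /-- The noise `n̂'_g` of the representations, with law `CN(0, I_K)`. -/
  u : Ω → Fin K → ℂ
  /-- The six are independent, with the laws above. -/
  hasLaw : HasLaw (fun ω => (x ω, n ω, H ω, w ω, v ω, u ω))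
    ((complexGaussianVec K 1).prod ((complexGaussianVec M noiseVar).prod
      ((rayleigh M K).prod ((complexGaussianVec K 1).prod
        ((complexGaussianVec K 1).prod (complexGaussianVec K 1)))))) μ

namespace Scheme

open Matrix

variable {Ω : Type*} [MeasurableSpace Ω] {μ : Measure Ω} {M K m : ℕ} (S : Scheme μ M K m)

/-- The channel matrix as a matrix. -/
def Hmat (ω : Ω) : Matrix (Fin M) (Fin K) ℂ := Matrix.of (S.H ω)

/-- The relay observation `y = H x + n`. -/
def y (ω : Ω) : Fin M → ℂ := S.Hmat ω *ᵥ S.x ω + S.n ω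

/-- The zero-forcing estimate `x̃ = (Hᴴ H)⁻¹ Hᴴ y`. -/
def xTilde (ω : Ω) : Fin K → ℂ :=
  (((S.Hmat ω)ᴴ * S.Hmat ω)⁻¹ * (S.Hmat ω)ᴴ) *ᵥ S.y ω

/-- The conditional covariance matrix `A = σ² (Hᴴ H)⁻¹` of the noise in the zero-forcing
estimate. -/
def A (ω : Ω) : Matrix (Fin K) (Fin K) ℂ :=
  (((S.noiseVar : ℝ) : ℂ)) • ((S.Hmat ω)ᴴ * S.Hmat ω)⁻¹

/-- The noise levels `a_k`, i.e. the (real) diagonal entries of `A`. -/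
def a (k : Fin K) (ω : Ω) : ℝ := (S.A ω k k).re

/-- The diagonal of `A₁' = diag(⌈a_1⌉, …, ⌈a_K⌉)`. -/
def A1' (ω : Ω) : Fin K → ℝ≥0∞ := fun k => ceilGrid S.b (S.a k ω)

/-- The degraded zero-forcing estimate `x̂ = x̃ + ñ'`, where, given everything else, `ñ'` has law
`CN(0, diag(⌈a_k⌉ - a_k))`. A component whose quantized noise level is infinite carries no signal:
it is erased, i.e. set to zero. -/
def xHat (ω : Ω) : Fin K → ℂ := fun k =>
  if S.A1' ω k = ∞ then 0
  else S.xTilde ω k + ((Real.sqrt ((S.A1' ω k).toReal - S.a k ω) : ℝ) : ℂ) * S.w ω k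

/-- The auxiliary signal `x̂_g = x + n̂_g`, where, given everything else, `n̂_g` has law
`CN(0, A₁')`; components with infinite noise level are again erased. -/
def xHatG (ω : Ω) : Fin K → ℂ := fun k =>
  if S.A1' ω k = ∞ then 0
  else S.x ω k + ((Real.sqrt (S.A1' ω k).toReal : ℝ) : ℂ) * S.v ω k

/-- The representation `z = Φ x̂ + n̂'_g`, where the diagonal `φ` of `Φ` may depend on `A₁'`. -/
def z (φ : (Fin K → ℝ≥0∞) → Fin K → ℝ≥0) (ω : Ω) : Fin K → ℂ := fun k =>
  ((φ (S.A1' ω) k : ℝ) : ℂ) * S.xHat ω k + S.u ω k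

/-- The representation `ẑ_g = Φ x̂_g + n̂'_g`. -/
def zHatG (φ : (Fin K → ℝ≥0∞) → Fin K → ℝ≥0) (ω : Ω) : Fin K → ℂ := fun k =>
  ((φ (S.A1' ω) k : ℝ) : ℂ) * S.xHatG ω k + S.u ω k

/-- The probability `P_j` that the noise level `a_k` is quantized to `b_j`. -/
def P (k : Fin K) (j : Fin (m + 1)) : ℝ := μ.real (S.a k ⁻¹' cell S.b j)

/-- The entropy `-∑ P_j log P_j`, in bits, of the quantized noise level `⌈a_k⌉`. -/
def H0 (k : Fin K) : ℝ := -∑ j : Fin (m + 1), S.P k j * Real.logb 2 (S.P k j)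

/-- `ρ_j = 1 / b_j`. -/
def rho (j : Fin (m + 1)) : ℝ := 1 / (S.b j).toReal

/-- The rate `c_j = [log (ρ_j / ν)]⁺` allocated to the noise level `b_j`. -/
def c (ν : ℝ) (j : Fin (m + 1)) : ℝ := max (Real.logb 2 (S.rho j / ν)) 0

/-- The rate `∑_{j < J} K P_j [log (1 + ρ_j) - log (1 + ρ_j 2^{-c_j})]`. -/
def Rlb2 (k : Fin K) (ν : ℝ) : ℝ :=
  ∑ j : Fin m, K * S.P k j.castSucc *
    (Real.logb 2 (1 + S.rho j.castSucc) -
      Real.logb 2 (1 + S.rho j.castSucc * 2 ^ (-S.c ν j.castSucc)))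

/-- The bottleneck constraint `I(x̂_g; ẑ_g | A₁') ≤ C - K H₀` for the fading matrix `Φ`. -/
def Feasible (k : Fin K) (C : ℝ) (φ : (Fin K → ℝ≥0∞) → Fin K → ℝ≥0) : Prop :=
  condMutualInfo S.xHatG (S.zHatG φ) S.A1' μ ≤ ENNReal.ofReal (C - K * S.H0 k)

/-- `Φ` is optimally chosen: it satisfies the bottleneck constraint, and among the representations
`ẑ_g = Φ x̂_g + n̂'_g` that do it maximizes `I(x; ẑ_g | A₁')`. In particular this holds if `ẑ_g`
is optimal among all representations of `x̂_g` that satisfy the constraint. -/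
def Optimal (k : Fin K) (C : ℝ) (φ : (Fin K → ℝ≥0∞) → Fin K → ℝ≥0) : Prop :=
  S.Feasible k C φ ∧ ∀ ψ : (Fin K → ℝ≥0∞) → Fin K → ℝ≥0, S.Feasible k C ψ →
    condMutualInfo S.x (S.zHatG ψ) S.A1' μ ≤ condMutualInfo S.x (S.zHatG φ) S.A1' μ

end Scheme

end

end QCI

/-! Condition on `A₁' = w`. Since `A₁'` is a function of `H`, the other random variables keep their
laws and their independence (`cond_sampleLaw`). As `Hᴴ H` is almost surely invertible
(`ae_isUnit_det_gram`), an unerased component of `x̂` is `x k` plus noise, and the artificial noise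
raises the variance `a_k` to exactly `w k`, whatever `H` is (`moments_zfNoise`). Given only `w`,
this noise need be neither Gaussian nor independent across components, but it has the same
componentwise power as the noise in `x̂_g`. The two inequalities are therefore extremal properties
of Gaussian laws with independent components: such an input maximizes information under Gaussian
noise of given power (`mutualInfo_le_of_gaussian_noise`), and such a noise minimizes information for
a Gaussian input (`le_mutualInfo_of_gaussian_input`).

Both extremal bounds use one function, the log-likelihood ratio `logRatioVec` of the Gaussian
channel. It is quadratic, so its mean depends only on second moments and equals `∑ log (s k / t k)`.
For the upper bound, the information is at most the divergence from the product of the input law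
with a Gaussian output law, and that divergence is this mean. For the lower bound, the function is
inserted into the Gibbs variational inequality; it is admissible because its exponential integrates
to one over the Gaussian input for every fixed output (`lintegral_exp_logRatio`).

What remains is an optimization of averages over `w` of `∑ relayRate` and `∑ sourceRate`. Expressed
through the rate `r` spent, the rate conveyed is `log (1 + ρ) - log (1 + ρ 2^(-r))`, which is
concave in `r`. Its supporting line at the water-filling allocation can be given the same slope `ν /
(1 + ν)` at every level (`sourceRate_le`). Averaging gives a Lagrangian bound by `Rlb2` for every
feasible `Φ`, and `allocatedFading` attains it, so a maximizer is exhibited explicitly. -/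

namespace QCI

/-! ### Variational bounds on relative entropy and mutual information. -/

section Divergence

open InformationTheory

variable {α β : Type*} [MeasurableSpace α] [MeasurableSpace β]

/-- A variational lower bound on the Kullback-Leibler divergence (Gibbs, Donsker-Varadhan). -/
lemma ofReal_integral_le_klDiv (μ ν : Measure α) [IsProbabilityMeasure μ] [IsProbabilityMeasure ν]
    {L : α → ℝ} (hL : Measurable L) (hLμ : Integrable L μ)
    (hLν : ∫⁻ a, ENNReal.ofReal (Real.exp (L a)) ∂ν ≤ 1) :
    ENNReal.ofReal (∫ a, L a ∂μ) ≤ klDiv μ ν := by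
  by_cases h : klDiv μ ν = ∞
  · simp [h]
  obtain ⟨hac, hint⟩ := klDiv_ne_top_iff.1 h
  rw [← ENNReal.ofReal_toReal h]
  refine ENNReal.ofReal_le_ofReal ?_
  rw [toReal_klDiv_eq_integral_klFun hac]
  have hexp : Integrable (fun a => Real.exp (L a)) ν := by
    refine ⟨(Real.measurable_exp.comp hL).aestronglyMeasurable, ?_⟩
    rw [hasFiniteIntegral_iff_ofReal (ae_of_all _ fun a => (Real.exp_pos _).le)]
    exact hLν.trans_lt ENNReal.one_lt_top
  have hexp1 : ∫ a, Real.exp (L a) ∂ν ≤ 1 := by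
    rw [integral_eq_lintegral_of_nonneg_ae (ae_of_all _ fun a => (Real.exp_pos _).le)
      (Real.measurable_exp.comp hL).aestronglyMeasurable]
    exact ENNReal.toReal_mono ENNReal.one_ne_top hLν |>.trans (by simp)
  have hkl : Integrable (fun a => klFun (μ.rnDeriv ν a).toReal) ν :=
    (integrable_klFun_rnDeriv_iff hac).2 hint
  have hrL : Integrable (fun a => (μ.rnDeriv ν a).toReal * L a) ν :=
    (integrable_toReal_rnDeriv_mul_iff hac).2 hLμ
  -- Fenchel-Young inequality for the conjugate functions `r log r - r` and `exp`, applied pointwise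
  -- to the density `r` and the test value `L a`.
  have key : ∀ a, (μ.rnDeriv ν a).toReal * L a + 1 - Real.exp (L a)
      ≤ klFun (μ.rnDeriv ν a).toReal := by
    intro a
    have hr : 0 ≤ (μ.rnDeriv ν a).toReal := ENNReal.toReal_nonneg
    generalize (μ.rnDeriv ν a).toReal = r at hr
    rw [klFun_apply]
    rcases hr.eq_or_lt with rfl | hr
    · simp [(Real.exp_pos _).le]
    have h1 := Real.add_one_le_exp (L a - Real.log r)
    rw [Real.exp_sub, Real.exp_log hr, le_div_iff₀ hr] at h1
    nlinarith
  have h2 := integral_mono ((hrL.add (integrable_const 1)).sub hexp) hkl key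
  have h3 : ∫ a, (μ.rnDeriv ν a).toReal * L a + 1 - Real.exp (L a) ∂ν
      = ∫ a, L a ∂μ + 1 - ∫ a, Real.exp (L a) ∂ν := by
    have h5 := integral_sub (hrL.add (integrable_const (1 : ℝ))) hexp
    have h6 := integral_add hrL (integrable_const (1 : ℝ))
    rw [integral_toReal_rnDeriv_mul hac, integral_const, probReal_univ, one_smul] at h6
    rw [← h6]
    exact h5
  have h4 : ∫ a, (μ.rnDeriv ν a).toReal * L a + 1 - Real.exp (L a) ∂ν
      ≤ ∫ a, klFun (μ.rnDeriv ν a).toReal ∂ν := h2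
  linarith

/-- The divergence from `ν` of a probability measure with density `exp L` with respect to `ν`. -/
lemma klDiv_withDensity_exp (ν : Measure α) [IsProbabilityMeasure ν] {L : α → ℝ}
    (hL : Measurable L) (μ : Measure α) [IsProbabilityMeasure μ]
    (hμ : μ = ν.withDensity fun a => ENNReal.ofReal (Real.exp (L a))) (hLμ : Integrable L μ) :
    klDiv μ ν = ENNReal.ofReal (∫ a, L a ∂μ) := by
  have hm : Measurable fun a => ENNReal.ofReal (Real.exp (L a)) := by fun_prop
  have hac : μ ≪ ν := hμ ▸ withDensity_absolutelyContinuous _ _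
  have hllr : llr μ ν =ᵐ[μ] L := by
    have h1 : μ.rnDeriv ν =ᵐ[ν] fun a => ENNReal.ofReal (Real.exp (L a)) := by
      rw [hμ]; exact Measure.rnDeriv_withDensity ν hm
    filter_upwards [hac.ae_eq h1] with a ha
    rw [llr, ha, ENNReal.toReal_ofReal (Real.exp_pos _).le, Real.log_exp]
  rw [klDiv_of_ac_of_integrable hac (hLμ.congr hllr.symm), integral_congr_ae hllr]
  simp

/-- Data processing along `e` and along its inverse. -/
lemma klDiv_map_equiv (e : α ≃ᵐ β) (μ ν : Measure α) [IsFiniteMeasure μ] [IsFiniteMeasure ν] :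
    klDiv (μ.map e) (ν.map e) = klDiv μ ν := by
  refine le_antisymm (klDiv_map_le μ ν e.measurable) ?_
  have := klDiv_map_le (μ.map e) (ν.map e) e.symm.measurable
  rwa [MeasurableEquiv.map_symm_map, MeasurableEquiv.map_symm_map] at this

variable {Ω : Type*} [MeasurableSpace Ω]

/-- The mutual information is the least divergence of the joint law from a product measure whose
first factor is the law of `X`. -/
lemma klDiv_prod_map_le [StandardBorelSpace α] [Nonempty α] {X : Ω → α} {Z : Ω → β}
    (μ : Measure Ω) [IsProbabilityMeasure μ] (hX : Measurable X) (hZ : Measurable Z)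
    (Q : Measure β) [IsProbabilityMeasure Q] :
    klDiv (μ.map fun ω => (X ω, Z ω)) ((μ.map X).prod (μ.map Z))
      ≤ klDiv (μ.map fun ω => (X ω, Z ω)) ((μ.map X).prod Q) := by
  have := Measure.isProbabilityMeasure_map (μ := μ) hX.aemeasurable
  have := Measure.isProbabilityMeasure_map (μ := μ) hZ.aemeasurable
  have := Measure.isProbabilityMeasure_map (μ := μ) (hX.prodMk hZ).aemeasurable
  have e1 : ∀ ρ : Measure β, [IsProbabilityMeasure ρ] →
      klDiv (μ.map fun ω => (X ω, Z ω)) ((μ.map X).prod ρ)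
        = klDiv ((μ.map Z) ⊗ₘ condDistrib X Z μ) (ρ ⊗ₘ Kernel.const β (μ.map X)) := by
    intro ρ _
    rw [compProd_map_condDistrib hX.aemeasurable, Measure.compProd_const,
      ← klDiv_map_equiv MeasurableEquiv.prodComm,
      Measure.map_map MeasurableEquiv.prodComm.measurable (hX.prodMk hZ)]
    congr 1
    exact Measure.prod_swap
  -- With `Z` in front, the chain rule splits off the divergence of the law of `Z` from `Q`, which
  -- is exactly the excess over the mutual information.
  rw [e1, e1, klDiv_compProd_eq_add (μ.map Z) Q]
  exact le_add_self

end Divergence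

end QCI

namespace QCI

/-! ### Circularly symmetric Gaussian laws: transforms, scaling, sums and densities. -/

section ComplexGaussian

lemma measurable_complex_mk : Measurable fun p : ℝ × ℝ => (⟨p.1, p.2⟩ : ℂ) :=
  Complex.measurableEquivRealProd.symm.measurable

instance isProbabilityMeasure_complexGaussian (s : ℝ≥0) :
    IsProbabilityMeasure (complexGaussian s) :=
  Measure.isProbabilityMeasure_map measurable_complex_mk.aemeasurable

instance isProbabilityMeasure_complexGaussianVec (d : ℕ) (s : ℝ≥0) :
    IsProbabilityMeasure (complexGaussianVec d s) := by
  unfold complexGaussianVec; infer_instance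

instance sigmaFinite_complexGaussianVec (d : ℕ) (s : ℝ≥0) :
    SigmaFinite (complexGaussianVec d s) :=
  IsFiniteMeasure.toSigmaFinite _

instance isProbabilityMeasure_rayleigh (M K : ℕ) : IsProbabilityMeasure (rayleigh M K) := by
  unfold rayleigh; infer_instance

lemma complexGaussian_zero : complexGaussian 0 = Measure.dirac 0 := by
  rw [complexGaussian, zero_div, gaussianReal_zero_var, Measure.dirac_prod_dirac,
    Measure.map_dirac' measurable_complex_mk]
  rfl

/-- Each real coordinate has variance `s / 2`, whence the factor 4. Scaling and convolution are read
off from this formula. -/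
lemma charFun_complexGaussian (s : ℝ≥0) (t : ℂ) :
    charFun (complexGaussian s) t = Complex.exp (-(s * (‖t‖ : ℂ) ^ 2 / 4)) := by
  rw [charFun_apply, complexGaussian, integral_map measurable_complex_mk.aemeasurable]
  · have h : ∀ p : ℝ × ℝ, Complex.exp (inner ℝ (⟨p.1, p.2⟩ : ℂ) t * Complex.I)
        = Complex.exp (p.1 * t.re * Complex.I) * Complex.exp (p.2 * t.im * Complex.I) := by
      intro p
      rw [← Complex.exp_add, Complex.inner]
      congr 1
      simp
      ring
    simp_rw [h]
    rw [integral_prod_mul (μ := gaussianReal 0 (s / 2)) (ν := gaussianReal 0 (s / 2))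
      (fun x : ℝ => Complex.exp (x * t.re * Complex.I))
      (fun x : ℝ => Complex.exp (x * t.im * Complex.I))]
    have h2 : ∀ r : ℝ, ∫ x : ℝ, Complex.exp (x * r * Complex.I) ∂(gaussianReal 0 (s / 2))
        = Complex.exp (-(s * (r : ℂ) ^ 2 / 4)) := by
      intro r
      have := charFun_gaussianReal (μ := 0) (v := s / 2) r
      rw [charFun_apply_real] at this
      rw [← integral_congr_ae (ae_of_all _ fun x => ?_), this]
      · congr 1; push_cast; ring
      · show _ = _
        congr 1; ring
    rw [h2, h2, ← Complex.exp_add]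
    congr 1
    have := Complex.sq_norm t
    rw [Complex.normSq_apply] at this
    rw [← Complex.ofReal_pow ‖t‖, this]
    push_cast
    ring
  · exact (by fun_prop : Measurable _).aestronglyMeasurable

lemma complexGaussian_map_const_mul (s : ℝ≥0) (c : ℝ) :
    (complexGaussian s).map (fun z => (c : ℂ) * z) = complexGaussian ((c ^ 2).toNNReal * s) := by
  have : IsProbabilityMeasure ((complexGaussian s).map (fun z => (c : ℂ) * z)) :=
    Measure.isProbabilityMeasure_map (by fun_prop)
  refine Measure.ext_of_charFun ?_
  ext t
  have h : (fun z : ℂ => (c : ℂ) * z) = fun z => c • z := by ext z; simp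
  rw [h, charFun_map_smul, charFun_complexGaussian, charFun_complexGaussian]
  congr 1
  have h2 : ((c ^ 2).toNNReal : ℝ) = c ^ 2 := Real.coe_toNNReal _ (sq_nonneg c)
  have h3 : (‖c • t‖ : ℝ) ^ 2 = c ^ 2 * ‖t‖ ^ 2 := by rw [norm_smul, mul_pow]; simp
  rw [← Complex.ofReal_pow, h3]
  rw [NNReal.coe_mul, h2]
  push_cast
  ring

lemma complexGaussian_conv (s t : ℝ≥0) :
    (complexGaussian s) ∗ (complexGaussian t) = complexGaussian (s + t) := by
  refine Measure.ext_of_charFun ?_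
  ext u
  rw [charFun_conv, charFun_complexGaussian, charFun_complexGaussian, charFun_complexGaussian,
    ← Complex.exp_add]
  congr 1
  push_cast
  ring

lemma complexGaussian_prod_map (s t : ℝ≥0) (c d : ℝ) :
    ((complexGaussian s).prod (complexGaussian t)).map (fun p => (c : ℂ) * p.1 + (d : ℂ) * p.2)
      = complexGaussian ((c ^ 2).toNNReal * s + (d ^ 2).toNNReal * t) := by
  rw [← complexGaussian_conv, ← complexGaussian_map_const_mul, ← complexGaussian_map_const_mul,
    Measure.conv, Measure.map_prod_map _ _ (by fun_prop) (by fun_prop),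
    Measure.map_map (by fun_prop) (by fun_prop)]
  rfl

/-- Componentwise functions of two independent vectors with independent components. -/
lemma pi_prod_pi_map {ι α β γ : Type*} [Fintype ι] [MeasurableSpace α] [MeasurableSpace β]
    [MeasurableSpace γ] (μ : ι → Measure α) (ν : ι → Measure β) [∀ i, IsProbabilityMeasure (μ i)]
    [∀ i, IsProbabilityMeasure (ν i)] (F : ι → α × β → γ) (hF : ∀ i, Measurable (F i)) :
    ((Measure.pi μ).prod (Measure.pi ν)).map (fun p i => F i (p.1 i, p.2 i))
      = Measure.pi fun i => ((μ i).prod (ν i)).map (F i) := by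
  have : ∀ i, IsProbabilityMeasure (((μ i).prod (ν i)).map (F i)) := fun i =>
    Measure.isProbabilityMeasure_map (hF i).aemeasurable
  rw [← Measure.pi_map_pi (fun i => (hF i).aemeasurable),
    ← (measurePreserving_arrowProdEquivProdArrow α β ι μ ν).map_eq,
    Measure.map_map _ (MeasurableEquiv.measurable _)]
  · rfl
  · refine measurable_pi_lambda _ fun i => (hF i).comp ?_
    exact ((measurable_pi_apply i).comp measurable_fst).prodMk
      ((measurable_pi_apply i).comp measurable_snd)

/-! ### Densities -/

/-- The density of `CN(c, s)` with respect to Lebesgue measure. -/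
noncomputable def complexGaussianPDF (c : ℂ) (s : ℝ) (z : ℂ) : ℝ :=
  (Real.pi * s)⁻¹ * Real.exp (-(‖z - c‖ ^ 2 / s))

lemma complexGaussianPDF_nonneg (c : ℂ) {s : ℝ} (hs : 0 ≤ s) (z : ℂ) :
    0 ≤ complexGaussianPDF c s z := by
  unfold complexGaussianPDF; positivity

lemma measurable_complexGaussianPDF (c : ℂ) (s : ℝ) : Measurable (complexGaussianPDF c s) := by
  unfold complexGaussianPDF; fun_prop

lemma complexGaussian_eq_withDensity {s : ℝ≥0} (hs : s ≠ 0) :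
    complexGaussian s = volume.withDensity fun z => ENNReal.ofReal (complexGaussianPDF 0 s z) := by
  have hs2 : s / 2 ≠ 0 := by positivity
  have hs0 : (0 : ℝ) < s := by positivity
  have hdens : ∀ p : ℝ × ℝ, gaussianPDF 0 (s / 2) p.1 * gaussianPDF 0 (s / 2) p.2
      = ENNReal.ofReal (complexGaussianPDF 0 s (⟨p.1, p.2⟩ : ℂ)) := by
    intro p
    rw [gaussianPDF, gaussianPDF, ← ENNReal.ofReal_mul (gaussianPDFReal_nonneg _ _ _)]
    congr 1
    rw [gaussianPDFReal, gaussianPDFReal, complexGaussianPDF, mul_mul_mul_comm, ← Real.exp_add,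
      ← mul_inv, Real.mul_self_sqrt (by positivity)]
    congr 2
    · push_cast; ring
    · rw [Complex.sq_norm, Complex.normSq_apply]
      push_cast
      simp
      field_simp
      ring
  rw [complexGaussian, gaussianReal_of_var_ne_zero _ hs2,
    prod_withDensity (measurable_gaussianPDF _ _) (measurable_gaussianPDF _ _)]
  ext S hS
  rw [Measure.map_apply measurable_complex_mk hS, withDensity_apply _ (measurable_complex_mk hS),
    withDensity_apply _ hS, ← Complex.volume_preserving_equiv_real_prod.symm.setLIntegral_comp_preimage
      hS (measurable_complexGaussianPDF 0 s).ennreal_ofReal]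
  simp_rw [hdens]
  rfl

lemma lintegral_complexGaussianPDF (c : ℂ) {s : ℝ} (hs : 0 < s) :
    ∫⁻ z, ENNReal.ofReal (complexGaussianPDF c s z) = 1 := by
  lift s to ℝ≥0 using hs.le
  have h1 := measure_univ (μ := complexGaussian s)
  rw [complexGaussian_eq_withDensity (by exact_mod_cast hs.ne'), withDensity_apply _ .univ,
    Measure.restrict_univ] at h1
  rw [← h1, ← lintegral_sub_right_eq_self (fun z => ENNReal.ofReal (complexGaussianPDF 0 s z)) c]
  simp [complexGaussianPDF]

lemma complexGaussian_map_const_add {s : ℝ≥0} (hs : s ≠ 0) (c : ℂ) :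
    (complexGaussian s).map (fun z => c + z)
      = volume.withDensity fun z => ENNReal.ofReal (complexGaussianPDF c s z) := by
  ext S hS
  rw [Measure.map_apply (by fun_prop) hS, complexGaussian_eq_withDensity hs,
    withDensity_apply _ (measurable_const_add c hS), withDensity_apply _ hS,
    ← (measurePreserving_add_left volume c).setLIntegral_comp_preimage hS
      (measurable_complexGaussianPDF c s).ennreal_ofReal]
  simp [complexGaussianPDF]

end ComplexGaussian

end QCI

namespace QCI

/-! ### Product densities and the likelihood ratio of the Gaussian channel. -/

section Densities

lemma lintegral_pi_prod {ι : Type*} [Fintype ι] {α : ι → Type*} [∀ i, MeasurableSpace (α i)]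
    (μ : ∀ i, Measure (α i)) [∀ i, IsProbabilityMeasure (μ i)] (f : ∀ i, α i → ℝ≥0∞)
    (hf : ∀ i, Measurable (f i)) :
    ∫⁻ x, ∏ i, f i (x i) ∂(Measure.pi μ) = ∏ i, ∫⁻ y, f i y ∂(μ i) := by
  have h := iIndepFun_pi (μ := μ) (X := f) fun i => (hf i).aemeasurable
  rw [lintegral_prod_eq_prod_lintegral_of_indepFun Finset.univ _ h
    fun i => (hf i).comp (measurable_pi_apply i)]
  refine Finset.prod_congr rfl fun i _ => ?_
  exact (measurePreserving_eval μ i).lintegral_comp (hf i)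

lemma pi_withDensity {ι : Type*} [Fintype ι] {α : ι → Type*} [∀ i, MeasurableSpace (α i)]
    (μ : ∀ i, Measure (α i)) [∀ i, IsProbabilityMeasure (μ i)] (f : ∀ i, α i → ℝ≥0∞)
    (hf : ∀ i, Measurable (f i)) [∀ i, SigmaFinite ((μ i).withDensity (f i))] :
    Measure.pi (fun i => (μ i).withDensity (f i))
      = (Measure.pi μ).withDensity fun x => ∏ i, f i (x i) := by
  refine Measure.pi_eq fun s hs => ?_
  rw [withDensity_apply _ (.univ_pi hs), ← lintegral_indicator (.univ_pi hs)]
  -- The indicator of a box is a product of indicators, so the integral over the box factorizes.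
  have h : ∀ x, (Set.univ.pi s).indicator (fun x => ∏ i, f i (x i)) x
      = ∏ i, (s i).indicator (f i) (x i) := by
    intro x
    by_cases hx : x ∈ Set.univ.pi s
    · rw [Set.indicator_of_mem hx]
      exact Finset.prod_congr rfl fun i _ => (Set.indicator_of_mem (hx i trivial) _).symm
    · rw [Set.indicator_of_notMem hx]
      simp only [Set.mem_pi, not_forall] at hx
      obtain ⟨i, _, hi⟩ := hx
      exact (Finset.prod_eq_zero (Finset.mem_univ i) (Set.indicator_of_notMem hi _)).symm
  simp_rw [h]
  rw [lintegral_pi_prod μ _ fun i => (hf i).indicator (hs i)]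
  exact Finset.prod_congr rfl fun i _ => by
    rw [lintegral_indicator (hs i), withDensity_apply _ (hs i)]

/-- The logarithm of the ratio of the densities of `CN(φ x, t)` and `CN(0, s)` at `z`. -/
noncomputable def logRatio (φ t s : ℝ) (x z : ℂ) : ℝ :=
  Real.log (s / t) - ‖z - φ * x‖ ^ 2 / t + ‖z‖ ^ 2 / s

@[fun_prop]
lemma measurable_logRatio {α : Type*} [MeasurableSpace α] (φ t s : ℝ) {f g : α → ℂ}
    (hf : Measurable f) (hg : Measurable g) : Measurable fun a => logRatio φ t s (f a) (g a) := by
  unfold logRatio; fun_prop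

lemma exp_logRatio_mul_pdf (φ : ℝ) {t s : ℝ} (ht : 0 < t) (hs : 0 < s) (x z : ℂ) :
    Real.exp (logRatio φ t s x z) * complexGaussianPDF 0 s z = complexGaussianPDF (φ * x) t z := by
  rw [logRatio, complexGaussianPDF, complexGaussianPDF, sub_add, Real.exp_sub,
    Real.exp_log (by positivity), sub_zero]
  have h : Real.exp (-(‖z - φ * x‖ ^ 2 / t))
      = Real.exp (-(‖z‖ ^ 2 / s)) / Real.exp (‖z - φ * x‖ ^ 2 / t - ‖z‖ ^ 2 / s) := by
    rw [← Real.exp_sub]; congr 1; ring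
  rw [h]
  field_simp

lemma complexGaussian_withDensity_logRatio (φ : ℝ) {t s : ℝ≥0} (ht : t ≠ 0) (hs : s ≠ 0) (x : ℂ) :
    (complexGaussian s).withDensity (fun z => ENNReal.ofReal (Real.exp (logRatio φ t s x z)))
      = (complexGaussian t).map (fun z => (φ : ℂ) * x + z) := by
  have hm : Measurable fun z => ENNReal.ofReal (Real.exp (logRatio φ t s x z)) :=
    by fun_prop
  rw [complexGaussian_map_const_add ht, complexGaussian_eq_withDensity hs,
    ← withDensity_mul _ (measurable_complexGaussianPDF 0 s).ennreal_ofReal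
      hm]
  congr 1
  ext z
  rw [Pi.mul_apply, ← ENNReal.ofReal_mul (complexGaussianPDF_nonneg _ s.coe_nonneg _), mul_comm,
    exp_logRatio_mul_pdf φ (by positivity) (by positivity)]

/-- By Bayes' rule, under the power balance `hs` the likelihood ratio is also the density of the
posterior of `x` given `z` with respect to the prior `CN(0, p)`, hence it has total mass one for
each `z`. This is what frees the lower bound on the information from any knowledge of the law of the
output. -/
lemma lintegral_exp_logRatio (φ : ℝ) {t s p : ℝ≥0} (ht : t ≠ 0)
    (hs : (s : ℝ) = t + φ ^ 2 * p) (z : ℂ) :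
    ∫⁻ x, ENNReal.ofReal (Real.exp (logRatio φ t s x z)) ∂(complexGaussian p) = 1 := by
  have ht0 : (0 : ℝ) < t := by positivity
  have hs0 : (0 : ℝ) < s := by rw [hs]; positivity
  have hm : Measurable fun x => ENNReal.ofReal (Real.exp (logRatio φ t s x z)) :=
    by fun_prop
  -- A component without power has a Dirac prior, which has no Lebesgue density.
  rcases eq_or_ne p 0 with rfl | hp
  · have hst : s = t := by
      rw [← NNReal.coe_inj, hs]; simp
    subst hst
    rw [complexGaussian_zero, lintegral_dirac' _ hm]
    simp [logRatio, hs0.ne']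
  have hp0 : (0 : ℝ) < p := by positivity
  rw [complexGaussian_eq_withDensity hp, lintegral_withDensity_eq_lintegral_mul _
    (measurable_complexGaussianPDF 0 p).ennreal_ofReal hm,
    -- Completing the square in `x` shows that the posterior is `CN(φ p z / s, p t / s)`.
    ← lintegral_complexGaussianPDF (((φ * p / s : ℝ) : ℂ) * z) (s := p * t / s) (by positivity)]
  refine lintegral_congr fun x => ?_
  rw [Pi.mul_apply, ← ENNReal.ofReal_mul (complexGaussianPDF_nonneg _ p.coe_nonneg _)]
  congr 1
  rw [logRatio, complexGaussianPDF, complexGaussianPDF, sub_add, Real.exp_sub (Real.log _),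
    Real.exp_log (by positivity), sub_zero]
  have e : (Real.pi * (p : ℝ))⁻¹ * Real.exp (-(‖x‖ ^ 2 / p)) * ((s : ℝ) / t /
      Real.exp (‖z - φ * x‖ ^ 2 / t - ‖z‖ ^ 2 / s))
      = (Real.pi * (p * t / s))⁻¹ * Real.exp (-(‖x‖ ^ 2 / p)
        + -(‖z - φ * x‖ ^ 2 / t - ‖z‖ ^ 2 / s)) := by
    rw [Real.exp_add, Real.exp_neg (‖z - φ * x‖ ^ 2 / t - ‖z‖ ^ 2 / s)]; field_simp
  rw [e]
  congr 2
  simp only [Complex.sq_norm, Complex.normSq_apply, Complex.sub_re, Complex.sub_im,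
    Complex.mul_re, Complex.mul_im, Complex.ofReal_re, Complex.ofReal_im]
  rw [hs] at hs0 ⊢
  field_simp
  ring

end Densities

/-! ### Second moments and Pythagoras for independent variables. -/

section Moments

variable {Ω : Type*} [MeasurableSpace Ω] {μ : Measure Ω}

lemma memLp_id_complexGaussian (s : ℝ≥0) : MemLp (fun z : ℂ => z) 2 (complexGaussian s) := by
  have h : MemLp (fun p : ℝ × ℝ => (⟨p.1, p.2⟩ : ℂ)) 2
      ((gaussianReal 0 (s / 2)).prod (gaussianReal 0 (s / 2))) := by
    have h1 : MemLp (fun p : ℝ × ℝ => (p.1 : ℂ)) 2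
        ((gaussianReal 0 (s / 2)).prod (gaussianReal 0 (s / 2))) :=
      ((memLp_id_gaussianReal' 2 (by simp)).comp_measurePreserving
        (measurePreserving_fst)).ofReal
    have h2 : MemLp (fun p : ℝ × ℝ => (p.2 : ℂ)) 2
        ((gaussianReal 0 (s / 2)).prod (gaussianReal 0 (s / 2))) :=
      ((memLp_id_gaussianReal' 2 (by simp)).comp_measurePreserving
        (measurePreserving_snd)).ofReal
    refine (h1.add (h2.const_mul Complex.I)).ae_eq (ae_of_all _ fun p => ?_)
    apply Complex.ext <;> simp
  exact (memLp_map_measure_iff (by fun_prop) measurable_complex_mk.aemeasurable).2 h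

/-- The law is invariant under `z ↦ -z`. -/
lemma integral_id_complexGaussian (s : ℝ≥0) : ∫ z, z ∂(complexGaussian s) = 0 := by
  have h := complexGaussian_map_const_mul s (-1)
  have h1 : ∫ z, z ∂((complexGaussian s).map fun z => ((-1 : ℝ) : ℂ) * z)
      = ∫ z, z ∂(complexGaussian s) := by rw [h]; simp
  rw [integral_map (by fun_prop) (by fun_prop)] at h1
  simp only [Complex.ofReal_neg, Complex.ofReal_one, neg_mul, one_mul] at h1
  rw [integral_neg] at h1
  exact self_eq_neg.1 h1.symm

lemma integral_sq_gaussianReal (v : ℝ≥0) : ∫ x, x ^ 2 ∂(gaussianReal 0 v) = v := by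
  have h := variance_fun_id_gaussianReal (μ := 0) (v := v)
  rw [variance_eq_sub (X := fun x : ℝ => x) (memLp_id_gaussianReal' 2 (by simp))] at h
  simpa using h

lemma integral_norm_sq_complexGaussian (s : ℝ≥0) :
    ∫ z, ‖z‖ ^ 2 ∂(complexGaussian s) = s := by
  rw [complexGaussian, integral_map measurable_complex_mk.aemeasurable (by fun_prop)]
  have hi : Integrable (fun x : ℝ => x ^ 2) (gaussianReal 0 (s / 2)) :=
    (memLp_id_gaussianReal' (μ := 0) (v := s / 2) 2 (by simp)).integrable_sq
  have h : ∀ p : ℝ × ℝ, ‖(⟨p.1, p.2⟩ : ℂ)‖ ^ 2 = p.1 ^ 2 + p.2 ^ 2 := fun p => by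
    rw [Complex.sq_norm, Complex.normSq_apply]; ring
  simp_rw [h]
  rw [integral_add (hi.comp_fst _) (hi.comp_snd _), integral_fun_fst (f := fun x : ℝ => x ^ 2),
    integral_fun_snd (f := fun x : ℝ => x ^ 2), integral_sq_gaussianReal]
  simp

lemma _root_.MeasureTheory.MemLp.integrable_norm_sq {X : Ω → ℂ} (hX : MemLp X 2 μ) :
    Integrable (fun ω => ‖X ω‖ ^ 2) μ :=
  hX.norm.integrable_sq

/-- Pythagoras for independent random variables, one of which is centred. -/
lemma integral_norm_sq_add [IsProbabilityMeasure μ] {X Y : Ω → ℂ} (hX : MemLp X 2 μ)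
    (hY : MemLp Y 2 μ) (hXY : IndepFun X Y μ) (hX0 : ∫ ω, X ω ∂μ = 0) :
    ∫ ω, ‖X ω + Y ω‖ ^ 2 ∂μ = ∫ ω, ‖X ω‖ ^ 2 ∂μ + ∫ ω, ‖Y ω‖ ^ 2 ∂μ := by
  have hc : IndepFun X (fun ω => (starRingEnd ℂ) (Y ω)) μ :=
    hXY.comp measurable_id Complex.continuous_conj.measurable
  have hYc : MemLp (fun ω => (starRingEnd ℂ) (Y ω)) 2 μ := hY.star
  have hint : Integrable (fun ω => X ω * (starRingEnd ℂ) (Y ω)) μ := hX.integrable_mul hYc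
  have h0 : ∫ ω, X ω * (starRingEnd ℂ) (Y ω) ∂μ = 0 := by
    rw [hc.integral_fun_mul_eq_mul_integral hX.aestronglyMeasurable hYc.aestronglyMeasurable, hX0,
      zero_mul]
  have hre : ∫ ω, (X ω * (starRingEnd ℂ) (Y ω)).re ∂μ = 0 := by
    have := integral_re (𝕜 := ℂ) hint
    rw [h0] at this
    simpa using this
  have hreint : Integrable (fun ω => (X ω * (starRingEnd ℂ) (Y ω)).re) μ := hint.re
  have e : ∀ ω, ‖X ω + Y ω‖ ^ 2 = ‖X ω‖ ^ 2 + ‖Y ω‖ ^ 2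
      + 2 * (X ω * (starRingEnd ℂ) (Y ω)).re := by
    intro ω
    simp only [Complex.sq_norm, Complex.normSq_add]
  simp_rw [e]
  have h1 := integral_add (hX.integrable_norm_sq.add hY.integrable_norm_sq) (hreint.const_mul 2)
  simp only [Pi.add_apply] at h1
  rw [h1, integral_add hX.integrable_norm_sq hY.integrable_norm_sq, integral_const_mul, hre]
  simp

lemma integral_norm_sq_sum [IsProbabilityMeasure μ] {ι : Type*} {Y : ι → Ω → ℂ}
    (hm : ∀ i, Measurable (Y i)) (hY : ∀ i, MemLp (Y i) 2 μ) (hind : iIndepFun Y μ)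
    (h0 : ∀ i, ∫ ω, Y i ω ∂μ = 0) (s : Finset ι) :
    ∫ ω, ‖∑ i ∈ s, Y i ω‖ ^ 2 ∂μ = ∑ i ∈ s, ∫ ω, ‖Y i ω‖ ^ 2 ∂μ := by
  classical
  induction s using Finset.induction_on with
  | empty => simp
  | insert i s hi ih =>
    simp_rw [Finset.sum_insert hi]
    rw [integral_norm_sq_add (hY i) (memLp_finsetSum s fun j _ => hY j) _ (h0 i), ih]
    have := (hind.indepFun_finsetSum_of_notMem hm hi).symm
    convert this using 1
    ext ω
    simp

end Moments

end QCI

namespace QCI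

/-! ### The two extremal properties of Gaussian channels. -/

section Channel

open InformationTheory

variable {Ω : Type*} [MeasurableSpace Ω] {ι : Type*} [Fintype ι]

/-- The logarithm of the ratio of the densities of the laws of independent `CN(φ x, t)` and
`CN(0, s)` components. -/
noncomputable def logRatioVec (φ : ι → ℝ) (t s : ι → ℝ≥0) (q : (ι → ℂ) × (ι → ℂ)) : ℝ :=
  ∑ k, logRatio (φ k) (t k) (s k) (q.1 k) (q.2 k)

lemma measurable_logRatioVec (φ : ι → ℝ) (t s : ι → ℝ≥0) : Measurable (logRatioVec φ t s) := by
  unfold logRatioVec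
  fun_prop

lemma ofReal_exp_logRatioVec (φ : ι → ℝ) (t s : ι → ℝ≥0) (q : (ι → ℂ) × (ι → ℂ)) :
    ENNReal.ofReal (Real.exp (logRatioVec φ t s q))
      = ∏ k, ENNReal.ofReal (Real.exp (logRatio (φ k) (t k) (s k) (q.1 k) (q.2 k))) := by
  rw [logRatioVec, Real.exp_sum, ENNReal.ofReal_prod_of_nonneg fun _ _ => (Real.exp_pos _).le]

/-- In each component the two quadratic terms have means `-1` and `+1` and cancel, leaving the
constant. Only the powers of `Z` and `Z - φ X` enter, not the shape of their laws. -/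
lemma integral_logRatioVec {μ : Measure Ω} [IsProbabilityMeasure μ] {X Z : Ω → ι → ℂ}
    {φ : ι → ℝ} {t s : ι → ℝ≥0} (ht : ∀ k, t k ≠ 0) (hs : ∀ k, s k ≠ 0)
    (hD : ∀ k, MemLp (fun ω => Z ω k - φ k * X ω k) 2 μ) (hZ : ∀ k, MemLp (fun ω => Z ω k) 2 μ)
    (hDt : ∀ k, ∫ ω, ‖Z ω k - φ k * X ω k‖ ^ 2 ∂μ = t k) (hZs : ∀ k, ∫ ω, ‖Z ω k‖ ^ 2 ∂μ = s k) :
    Integrable (fun ω => logRatioVec φ t s (X ω, Z ω)) μ ∧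
      ∫ ω, logRatioVec φ t s (X ω, Z ω) ∂μ = ∑ k, Real.log (s k / t k) := by
  have h1 : ∀ k, Integrable (fun ω => Real.log (s k / t k) - ‖Z ω k - φ k * X ω k‖ ^ 2 / t k) μ :=
    fun k => (integrable_const _).sub ((hD k).integrable_norm_sq.div_const _)
  have h2 : ∀ k, Integrable (fun ω => ‖Z ω k‖ ^ 2 / (s k : ℝ)) μ :=
    fun k => (hZ k).integrable_norm_sq.div_const _
  refine ⟨integrable_finsetSum _ fun k _ => (h1 k).add (h2 k), ?_⟩
  have h3 := integral_finsetSum Finset.univ fun k _ => (h1 k).add (h2 k)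
  simp only [Pi.add_apply] at h3
  simp only [logRatioVec, logRatio]
  rw [h3]
  refine Finset.sum_congr rfl fun k _ => ?_
  rw [integral_add (h1 k) (h2 k), integral_sub (integrable_const _)
    ((hD k).integrable_norm_sq.div_const _), integral_div, integral_div, hDt, hZs]
  have ht' : (t k : ℝ) ≠ 0 := by exact_mod_cast ht k
  have hs' : (s k : ℝ) ≠ 0 := by exact_mod_cast hs k
  simp [ht', hs']

lemma ofReal_div_ofReal_log_two (r : ℝ) :
    ENNReal.ofReal r / ENNReal.ofReal (Real.log 2) = ENNReal.ofReal (r / Real.log 2) :=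
  (ENNReal.ofReal_div_of_pos (Real.log_pos one_lt_two)).symm

lemma sum_logb_eq (f : ι → ℝ) :
    ∑ k, Real.logb 2 (f k) = (∑ k, Real.log (f k)) / Real.log 2 := by
  simp only [Real.logb, Finset.sum_div]

/-- A Gaussian input with independent components conveys at least the mutual information of the
corresponding additive Gaussian noise channel, whatever the distribution of the noise. -/
lemma le_mutualInfo_of_gaussian_input (μ : Measure Ω) [IsProbabilityMeasure μ]
    {X Z : Ω → ι → ℂ} (hXm : Measurable X) (hZm : Measurable Z) (φ : ι → ℝ) {t s p : ι → ℝ≥0}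
    (ht : ∀ k, t k ≠ 0) (hs : ∀ k, (s k : ℝ) = t k + φ k ^ 2 * p k)
    (hX : μ.map X = Measure.pi fun k => complexGaussian (p k))
    (hD : ∀ k, MemLp (fun ω => Z ω k - φ k * X ω k) 2 μ) (hZ : ∀ k, MemLp (fun ω => Z ω k) 2 μ)
    (hDt : ∀ k, ∫ ω, ‖Z ω k - φ k * X ω k‖ ^ 2 ∂μ = t k) (hZs : ∀ k, ∫ ω, ‖Z ω k‖ ^ 2 ∂μ = s k) :
    ENNReal.ofReal (∑ k, Real.logb 2 (s k / t k)) ≤ mutualInfo X Z μ := by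
  have := Measure.isProbabilityMeasure_map (μ := μ) hXm.aemeasurable
  have := Measure.isProbabilityMeasure_map (μ := μ) hZm.aemeasurable
  have := Measure.isProbabilityMeasure_map (μ := μ) (hXm.prodMk hZm).aemeasurable
  have hs0 : ∀ k, s k ≠ 0 := fun k h => by
    have h1 : (0 : ℝ) < t k := by have := ht k; positivity
    have h2 := hs k
    rw [h, NNReal.coe_zero] at h2
    have : 0 ≤ φ k ^ 2 * (p k : ℝ) := by positivity
    linarith
  obtain ⟨hint, hval⟩ := integral_logRatioVec ht hs0 hD hZ hDt hZs
  have hm := measurable_logRatioVec φ t s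
  rw [mutualInfo, sum_logb_eq, ← ofReal_div_ofReal_log_two]
  refine ENNReal.div_le_div_right ?_ _
  rw [← hval, ← integral_map (f := logRatioVec φ t s) (hXm.prodMk hZm).aemeasurable
    hm.aestronglyMeasurable]
  -- Gibbs' inequality with the Gaussian log-likelihood ratio as test function, although the true
  -- joint law need not be Gaussian.
  refine ofReal_integral_le_klDiv _ _ hm ?_ ?_
  · exact (integrable_map_measure hm.aestronglyMeasurable (hXm.prodMk hZm).aemeasurable).2 hint
  -- Integrating over the input first gives 1 for every output, so the law of `Z` plays no role.
  · rw [lintegral_prod_symm _ hm.exp.ennreal_ofReal.aemeasurable]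
    have : ∀ z, ∫⁻ x, ENNReal.ofReal (Real.exp (logRatioVec φ t s (x, z))) ∂(μ.map X) = 1 := by
      intro z
      simp_rw [ofReal_exp_logRatioVec]
      rw [hX, lintegral_pi_prod _ (fun k x =>
        ENNReal.ofReal (Real.exp (logRatio (φ k) (t k) (s k) x (z k))))
        fun k => by fun_prop]
      exact Finset.prod_eq_one fun k _ => lintegral_exp_logRatio (φ k) (ht k) (hs k) (z k)
    simp_rw [this]
    simp

/-- The capacity bound for the additive Gaussian noise channel with independent components. -/
lemma mutualInfo_le_of_gaussian_noise (μ : Measure Ω) [IsProbabilityMeasure μ]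
    {X N : Ω → ι → ℂ} (hXm : Measurable X) (hNm : Measurable N) (φ : ι → ℝ) {t s p : ι → ℝ≥0}
    (ht : ∀ k, t k ≠ 0) (hs : ∀ k, (s k : ℝ) = t k + φ k ^ 2 * p k)
    (hXN : μ.map (fun ω => (X ω, N ω))
      = (μ.map X).prod (Measure.pi fun k => complexGaussian (t k)))
    (hX : ∀ k, MemLp (fun ω => X ω k) 2 μ) (hXp : ∀ k, ∫ ω, ‖X ω k‖ ^ 2 ∂μ = p k) :
    mutualInfo X (fun ω k => (φ k : ℂ) * X ω k + N ω k) μ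
      ≤ ENNReal.ofReal (∑ k, Real.logb 2 (s k / t k)) := by
  set Z : Ω → ι → ℂ := fun ω k => (φ k : ℂ) * X ω k + N ω k with hZdef
  have hZm : Measurable Z := by
    refine measurable_pi_lambda _ fun k => ?_
    exact (((measurable_pi_apply k).comp hXm).const_mul _).add ((measurable_pi_apply k).comp hNm)
  have := Measure.isProbabilityMeasure_map (μ := μ) hXm.aemeasurable
  have := Measure.isProbabilityMeasure_map (μ := μ) hZm.aemeasurable
  have := Measure.isProbabilityMeasure_map (μ := μ) (hXm.prodMk hZm).aemeasurable
  have hs0 : ∀ k, s k ≠ 0 := fun k h => by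
    have h1 : (0 : ℝ) < t k := by have := ht k; positivity
    have h2 := hs k
    rw [h, NNReal.coe_zero] at h2
    have : 0 ≤ φ k ^ 2 * (p k : ℝ) := by positivity
    linarith
  have hNlaw : μ.map N = Measure.pi fun k => complexGaussian (t k) := by
    have := congrArg (Measure.map Prod.snd) hXN
    rw [Measure.map_map measurable_snd (hXm.prodMk hNm), Measure.map_snd_prod, measure_univ, one_smul] at this
    exact this
  have hind : IndepFun X N μ := by
    rw [indepFun_iff_map_prod_eq_prod_map_map hXm.aemeasurable hNm.aemeasurable, hXN, hNlaw]
  have hNk : ∀ k, MeasurePreserving (fun ω => N ω k) μ (complexGaussian (t k)) := fun k =>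
    (measurePreserving_eval (fun k => complexGaussian (t k)) k).comp ⟨hNm, hNlaw⟩
  have hNk2 : ∀ k, MemLp (fun ω => N ω k) 2 μ := fun k =>
    (memLp_id_complexGaussian (t k)).comp_measurePreserving (hNk k)
  have hNk0 : ∀ k, ∫ ω, N ω k ∂μ = 0 := fun k => by
    rw [← integral_id_complexGaussian (t k), ← (hNk k).map_eq,
      integral_map (hNk k).measurable.aemeasurable (by fun_prop)]
  have hNks : ∀ k, ∫ ω, ‖N ω k‖ ^ 2 ∂μ = t k := fun k => by
    rw [← integral_norm_sq_complexGaussian (t k), ← (hNk k).map_eq,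
      integral_map (hNk k).measurable.aemeasurable (by fun_prop)]
  have hZ2 : ∀ k, MemLp (fun ω => Z ω k) 2 μ := fun k => ((hX k).const_mul _).add (hNk2 k)
  have hDeq : ∀ k ω, Z ω k - φ k * X ω k = N ω k := fun k ω => by simp [hZdef]
  have hZs : ∀ k, ∫ ω, ‖Z ω k‖ ^ 2 ∂μ = s k := fun k => by
    have hi : IndepFun (fun ω => N ω k) (fun ω => (φ k : ℂ) * X ω k) μ :=
      (hind.symm).comp (φ := fun n : ι → ℂ => n k) (by fun_prop) (ψ := fun x : ι → ℂ => (φ k : ℂ) * x k)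
        (by fun_prop)
    have := integral_norm_sq_add (hNk2 k) ((hX k).const_mul (φ k : ℂ)) hi (hNk0 k)
    simp_rw [hZdef, add_comm ((φ k : ℂ) * _)]
    rw [this, hNks, hs]
    simp_rw [norm_mul, mul_pow]
    rw [integral_const_mul, hXp]
    simp
  obtain ⟨hint, hval⟩ := integral_logRatioVec (X := X) (Z := Z) (φ := φ) ht hs0
    (fun k => by simpa only [hDeq] using hNk2 k) hZ2
    (fun k => by simpa only [hDeq] using hNks k) hZs
  have hm := measurable_logRatioVec φ t s
  rw [mutualInfo, sum_logb_eq, ← ofReal_div_ofReal_log_two]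
  refine ENNReal.div_le_div_right ?_ _
  -- The unknown output law is replaced by the Gaussian law of the same componentwise power; this
  -- can only increase the divergence.
  refine (klDiv_prod_map_le μ hXm hZm (Measure.pi fun k => complexGaussian (s k))).trans ?_
  rw [← hval, ← integral_map (f := logRatioVec φ t s) (hXm.prodMk hZm).aemeasurable
    hm.aestronglyMeasurable]
  refine (klDiv_withDensity_exp _ hm _ ?_ ?_).le
  swap
  · exact (integrable_map_measure hm.aestronglyMeasurable (hXm.prodMk hZm).aemeasurable).2 hint
  have hcomp : (fun ω => (X ω, Z ω))
      = (fun q : (ι → ℂ) × (ι → ℂ) => (q.1, fun k => (φ k : ℂ) * q.1 k + q.2 k)) ∘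
        fun ω => (X ω, N ω) := rfl
  have hshift : Measurable fun q : (ι → ℂ) × (ι → ℂ) => (q.1, fun k => (φ k : ℂ) * q.1 k + q.2 k) := by
    fun_prop
  -- Given the input `x`, the output is shifted Gaussian noise, with density `exp logRatioVec`
  -- relative to the Gaussian output law. Hence the joint law has this density relative to the
  -- product.
  have hslice : ∀ x : ι → ℂ, (Measure.pi fun k => complexGaussian (t k)).map
      (fun n k => (φ k : ℂ) * x k + n k) = (Measure.pi fun k => complexGaussian (s k)).withDensity
        fun z => ENNReal.ofReal (Real.exp (logRatioVec φ t s (x, z))) := by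
    intro x
    have hp : ∀ k, IsProbabilityMeasure
        ((complexGaussian (t k)).map (fun z => (φ k : ℂ) * x k + z)) := fun k =>
      Measure.isProbabilityMeasure_map (by fun_prop)
    have hp' : ∀ k, IsProbabilityMeasure ((complexGaussian (s k)).withDensity
        (fun z => ENNReal.ofReal (Real.exp (logRatio (φ k) (t k) (s k) (x k) z)))) := fun k => by
      rw [complexGaussian_withDensity_logRatio (φ k) (ht k) (hs0 k) (x k)]; exact hp k
    rw [Measure.pi_map_pi (μ := fun k => complexGaussian (t k))
      (f := fun k z => (φ k : ℂ) * x k + z) (by fun_prop)]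
    have heq : (fun k => (complexGaussian (t k)).map fun z => (φ k : ℂ) * x k + z)
        = fun k => (complexGaussian (s k)).withDensity
          fun z => ENNReal.ofReal (Real.exp (logRatio (φ k) (t k) (s k) (x k) z)) :=
      funext fun k => (complexGaussian_withDensity_logRatio (φ k) (ht k) (hs0 k) (x k)).symm
    rw [heq, pi_withDensity _ fun k z =>
      ENNReal.ofReal (Real.exp (logRatio (φ k) (t k) (s k) (x k) z))]
    · simp_rw [ofReal_exp_logRatioVec]
    · exact fun k => by fun_prop
  rw [hcomp, ← Measure.map_map hshift (hXm.prodMk hNm), hXN]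
  ext S hS
  rw [Measure.map_apply hshift hS, Measure.prod_apply (hshift hS), withDensity_apply _ hS,
    ← lintegral_indicator hS, lintegral_prod _ (hm.exp.ennreal_ofReal.indicator hS).aemeasurable]
  refine lintegral_congr fun x => ?_
  have hSx : MeasurableSet (Prod.mk x ⁻¹' S) := measurable_prodMk_left hS
  have h1 : Prod.mk x ⁻¹' ((fun q : (ι → ℂ) × (ι → ℂ) =>
      (q.1, fun k => (φ k : ℂ) * q.1 k + q.2 k)) ⁻¹' S)
      = (fun n k => (φ k : ℂ) * x k + n k) ⁻¹' (Prod.mk x ⁻¹' S) := rfl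
  rw [h1, ← Measure.map_apply (by fun_prop) hSx, hslice, withDensity_apply _ hSx,
    ← lintegral_indicator hSx]
  rfl

end Channel

end QCI

namespace QCI

open Matrix

/-! ### Almost sure full rank of a Rayleigh matrix. -/

section Rank

/-- If each factor is mapped by `τ i` to a measure with a positive density, so is the product. -/
lemma exists_pi_map_eq_withDensity {ι : Type*} [Fintype ι] {α : ι → Type*}
    [∀ i, MeasurableSpace (α i)] (μ : ∀ i, Measure (α i)) [∀ i, IsProbabilityMeasure (μ i)]
    (τ : ∀ i, α i → α i) (hτ : ∀ i, Measurable (τ i))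
    (h : ∀ i, ∃ f : α i → ℝ≥0∞, Measurable f ∧ (∀ x, f x ≠ 0) ∧
      (μ i).map (τ i) = (μ i).withDensity f) :
    ∃ f : (∀ i, α i) → ℝ≥0∞, Measurable f ∧ (∀ x, f x ≠ 0) ∧
      (Measure.pi μ).map (fun x i => τ i (x i)) = (Measure.pi μ).withDensity f := by
  choose f hf hf0 hfμ using h
  have h1 : ∀ i, IsProbabilityMeasure ((μ i).map (τ i)) := fun i =>
    Measure.isProbabilityMeasure_map (hτ i).aemeasurable
  have h2 : ∀ i, IsProbabilityMeasure ((μ i).withDensity (f i)) := fun i => hfμ i ▸ h1 i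
  refine ⟨fun x => ∏ i, f i (x i), ?_, fun x => Finset.prod_ne_zero_iff.2 fun i _ => hf0 i _, ?_⟩
  · exact Finset.measurable_fun_prod _ fun i _ => (hf i).comp (measurable_pi_apply i)
  · rw [Measure.pi_map_pi fun i => (hτ i).aemeasurable, ← pi_withDensity μ f hf]
    simp_rw [hfμ]

/-- A translate of a Gaussian has a positive density with respect to it, so a set that is null for
one translate is null for the original law. -/
lemma rayleigh_absolutelyContinuous_map_add (M K : ℕ) (c : Fin M → Fin K → ℂ) :
    rayleigh M K ≪ (rayleigh M K).map fun h i j => c i j + h i j := by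
  obtain ⟨f, hf, hf0, hfμ⟩ := exists_pi_map_eq_withDensity
    (fun _ : Fin M => complexGaussianVec K 1) (fun i r j => c i j + r j) (fun i => by fun_prop)
    (fun i => exists_pi_map_eq_withDensity (fun _ : Fin K => complexGaussian 1)
      (fun j z => c i j + z) (fun j => by fun_prop) fun j =>
        ⟨fun z => ENNReal.ofReal (Real.exp (logRatio 1 1 1 (c i j) z)), by fun_prop,
          fun z => by simpa using Real.exp_pos _, by
            simpa using (complexGaussian_withDensity_logRatio 1 one_ne_zero one_ne_zero
              (c i j)).symm⟩)
  have : (rayleigh M K).map (fun h i j => c i j + h i j) = (rayleigh M K).withDensity f := hfμ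
  rw [this]
  exact withDensity_absolutelyContinuous' hf.aemeasurable (ae_of_all _ hf0)

/-- The determinant is the characteristic polynomial of `-A` at `t`, which is monic and has finitely
many roots. -/
lemma finite_det_add_smul_one {K : ℕ} (A : Matrix (Fin K) (Fin K) ℂ) :
    {t : ℝ | (A + (t : ℂ) • (1 : Matrix (Fin K) (Fin K) ℂ)).det = 0}.Finite := by
  have hfin : {z : ℂ | (-A).charpoly.IsRoot z}.Finite :=
    Polynomial.finite_setOfPred_isRoot (charpoly_monic _).ne_zero
  refine (hfin.preimage (Complex.ofReal_injective.injOn)).subset fun t ht => ?_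
  simp only [Set.mem_preimage, Set.mem_ofPred_eq, Polynomial.IsRoot, eval_charpoly] at ht ⊢
  rw [← ht]
  congr 1
  rw [sub_neg_eq_add, add_comm, smul_one_eq_diagonal]
  rfl

/-- The upper square block of a tall matrix. -/
def topBlock {M K : ℕ} (hKM : K ≤ M) (h : Fin M → Fin K → ℂ) : Matrix (Fin K) (Fin K) ℂ :=
  Matrix.of fun i j => h (Fin.castLE hKM i) j

lemma measurable_det {n : ℕ} : Measurable fun A : Fin n → Fin n → ℂ => (Matrix.of A).det := by
  simp only [det_apply]
  fun_prop

/-- Adding `t` along the diagonal makes a given block singular for finitely many `t` only. By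
Fubini, for almost every `t` the translated law gives the singular matrices mass zero, and a single
such `t` suffices because the original law is absolutely continuous with respect to the translated
one. -/
lemma ae_det_topBlock_ne_zero {M K : ℕ} (hKM : K ≤ M) :
    ∀ᵐ h ∂(rayleigh M K), (topBlock hKM h).det ≠ 0 := by
  have hc : ∀ (t : ℝ) (h : Fin M → Fin K → ℂ), topBlock hKM
      (fun i j => (if (i : ℕ) = j then (t : ℂ) else 0) + h i j)
      = topBlock hKM h + (t : ℂ) • (1 : Matrix (Fin K) (Fin K) ℂ) := by
    intro t h
    ext i j
    by_cases hij : i = j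
    · simp [topBlock, hij, add_comm]
    · have : (i : ℕ) ≠ j := fun h => hij (Fin.ext h)
      simp [topBlock, hij, this]
  have hm : Measurable fun h : Fin M → Fin K → ℂ => (topBlock hKM h).det :=
    measurable_det.comp (g := fun A : Fin K → Fin K → ℂ => (Matrix.of A).det)
      (f := fun (h : Fin M → Fin K → ℂ) i j => h (Fin.castLE hKM i) j) (by fun_prop)
  have hS : MeasurableSet {q : ℝ × (Fin M → Fin K → ℂ) | (topBlock hKM
      (fun i j => (if (i : ℕ) = j then (q.1 : ℂ) else 0) + q.2 i j)).det = 0} := by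
    refine (measurableSet_eq_fun hm measurable_const).preimage
      (f := fun q : ℝ × (Fin M → Fin K → ℂ) => fun (i : Fin M) (j : Fin K) =>
        (if (i : ℕ) = j then (q.1 : ℂ) else 0) + q.2 i j) ?_
    refine measurable_pi_lambda _ fun i => measurable_pi_lambda _ fun j => ?_
    by_cases hij : (i : ℕ) = j
    · simp only [hij, if_true]; fun_prop
    · simp only [hij, if_false]; fun_prop
  have h0 : ((volume : Measure ℝ).prod (rayleigh M K)) {q : ℝ × (Fin M → Fin K → ℂ) | (topBlock hKM
      (fun i j => (if (i : ℕ) = j then (q.1 : ℂ) else 0) + q.2 i j)).det = 0} = 0 := by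
    rw [Measure.prod_apply_symm hS, lintegral_eq_zero_iff (measurable_measure_prodMk_right hS)]
    refine ae_of_all _ fun h => ?_
    refine Set.Finite.measure_zero ?_ _
    refine (finite_det_add_smul_one (topBlock hKM h)).subset fun t ht => ?_
    simpa only [Set.mem_preimage, Set.mem_ofPred_eq, hc] using ht
  rw [Measure.measure_prod_null hS] at h0
  obtain ⟨t, ht⟩ := h0.exists
  have hac := rayleigh_absolutelyContinuous_map_add M K
    fun i j => if (i : ℕ) = j then (t : ℂ) else 0
  refine ae_iff.2 (hac ?_)
  simp only [ne_eq, not_not]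
  rw [Measure.map_apply (by fun_prop) (measurableSet_eq_fun hm measurable_const)]
  exact ht

-- The Gram matrix has the same kernel as `h`, and that kernel lies in the kernel of the top block.
open scoped ComplexOrder in
lemma isUnit_det_gram_of_topBlock {M K : ℕ} (hKM : K ≤ M) (h : Fin M → Fin K → ℂ)
    (hh : (topBlock hKM h).det ≠ 0) : IsUnit (((Matrix.of h)ᴴ * Matrix.of h).det) := by
  rw [isUnit_iff_ne_zero]
  intro h0
  obtain ⟨v, hv, hv0⟩ := exists_mulVec_eq_zero_iff.2 h0
  rw [conjTranspose_mul_self_mulVec_eq_zero] at hv0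
  refine hh (exists_mulVec_eq_zero_iff.1 ⟨v, hv, ?_⟩)
  ext i
  exact congrFun hv0 (Fin.castLE hKM i)

/-- A Rayleigh fading channel with at most as many inputs as outputs has full rank. -/
lemma ae_isUnit_det_gram {M K : ℕ} (hKM : K ≤ M) :
    ∀ᵐ h ∂(rayleigh M K), IsUnit (((Matrix.of h)ᴴ * Matrix.of h).det) := by
  filter_upwards [ae_det_topBlock_ne_zero hKM] with h hh
  exact isUnit_det_gram_of_topBlock hKM h hh

end Rank

/-! ### The zero-forcing filter and its error levels. -/

section PseudoInverse

variable {M K : ℕ}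

/-- The zero-forcing filter `(Hᴴ H)⁻¹ Hᴴ`. -/
noncomputable def zfFilter (h : Fin M → Fin K → ℂ) : Matrix (Fin K) (Fin M) ℂ :=
  ((Matrix.of h)ᴴ * Matrix.of h)⁻¹ * (Matrix.of h)ᴴ

/-- The error levels `((Hᴴ H)⁻¹)ₖₖ` of zero forcing, for unit noise variance. -/
noncomputable def zfError (h : Fin M → Fin K → ℂ) (k : Fin K) : ℝ :=
  ((((Matrix.of h)ᴴ * Matrix.of h)⁻¹) k k).re

lemma zfFilter_mul (h : Fin M → Fin K → ℂ) (hh : IsUnit (((Matrix.of h)ᴴ * Matrix.of h).det)) :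
    zfFilter h * Matrix.of h = 1 := by
  rw [zfFilter, Matrix.mul_assoc, nonsing_inv_mul _ hh]

/-- The filter `G` satisfies `G Gᴴ = (Hᴴ H)⁻¹`, whose diagonal consists of the squared row norms of
`G`. Up to the factor `σ²` these are the variances of the filtered channel noise given `H`. -/
lemma sum_norm_sq_zfFilter (h : Fin M → Fin K → ℂ)
    (hh : IsUnit (((Matrix.of h)ᴴ * Matrix.of h).det)) (k : Fin K) :
    ∑ j, ‖zfFilter h k j‖ ^ 2 = zfError h k := by
  have h1 : zfFilter h * (zfFilter h)ᴴ = ((Matrix.of h)ᴴ * Matrix.of h)⁻¹ := by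
    have hherm : (((Matrix.of h)ᴴ * Matrix.of h)⁻¹)ᴴ = ((Matrix.of h)ᴴ * Matrix.of h)⁻¹ := by
      rw [conjTranspose_nonsing_inv, conjTranspose_mul, conjTranspose_conjTranspose]
    conv_lhs => enter [2]; rw [zfFilter]
    rw [conjTranspose_mul, conjTranspose_conjTranspose, hherm, ← Matrix.mul_assoc,
      zfFilter_mul h hh, Matrix.one_mul]
  rw [zfError, ← h1, Matrix.mul_apply, Complex.re_sum]
  refine Finset.sum_congr rfl fun j _ => ?_
  rw [conjTranspose_apply, Complex.star_def, Complex.mul_conj, Complex.ofReal_re,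
    Complex.normSq_eq_norm_sq]

lemma measurable_inv_apply {n : ℕ} (i j : Fin n) :
    Measurable fun A : Fin n → Fin n → ℂ => (Matrix.of A)⁻¹ i j := by
  have h1 : Measurable fun A : Fin n → Fin n → ℂ => (Matrix.of A).adjugate i j := by
    simp only [adjugate_apply]
    refine measurable_det.comp (g := fun A : Fin n → Fin n → ℂ => (Matrix.of A).det)
      (f := fun A => (Matrix.of A).updateRow j (Pi.single i 1)) ?_
    refine measurable_pi_lambda _ fun a => measurable_pi_lambda _ fun b => ?_
    simp only [updateRow_apply]
    by_cases h : a = j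
    · simp only [h, if_true]; fun_prop
    · simp only [h, if_false, of_apply]; fun_prop
  simp only [inv_def, Matrix.smul_apply, smul_eq_mul, Ring.inverse_eq_inv']
  exact measurable_det.inv.mul h1

lemma measurable_gram_inv_apply (i j : Fin K) :
    Measurable fun h : Fin M → Fin K → ℂ => ((Matrix.of h)ᴴ * Matrix.of h)⁻¹ i j := by
  refine (measurable_inv_apply i j).comp (g := fun A : Fin K → Fin K → ℂ => (Matrix.of A)⁻¹ i j)
    (f := fun h : Fin M → Fin K → ℂ => (Matrix.of h)ᴴ * Matrix.of h) ?_
  refine measurable_pi_lambda _ fun a => measurable_pi_lambda _ fun b => ?_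
  simp only [Matrix.mul_apply, conjTranspose_apply, of_apply]
  refine Finset.measurable_fun_sum _ fun c _ => ?_
  exact (Complex.continuous_conj.measurable.comp (by fun_prop)).mul (by fun_prop)

@[fun_prop]
lemma measurable_zfError (k : Fin K) : Measurable fun h : Fin M → Fin K → ℂ => zfError h k :=
  Complex.measurable_re.comp (measurable_gram_inv_apply k k)

@[fun_prop]
lemma measurable_zfFilter (k : Fin K) (j : Fin M) :
    Measurable fun h : Fin M → Fin K → ℂ => zfFilter h k j := by
  simp only [zfFilter, Matrix.mul_apply (N := (Matrix.of _)ᴴ), conjTranspose_apply, of_apply]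
  refine Finset.measurable_fun_sum _ fun c _ => (measurable_gram_inv_apply k c).mul ?_
  exact Complex.continuous_conj.measurable.comp (by fun_prop)

lemma rayleigh_map_perm (σ : Equiv.Perm (Fin K)) :
    (rayleigh M K).map (fun h i j => h i (σ j)) = rayleigh M K := by
  have h1 : (complexGaussianVec K 1).map (fun r j => r (σ j)) = complexGaussianVec K 1 := by
    have := (measurePreserving_piCongrLeft (fun _ : Fin K => complexGaussian 1) σ.symm).map_eq
    rw [complexGaussianVec]
    convert this using 2
    ext r j
    simp [MeasurableEquiv.piCongrLeft, Equiv.piCongrLeft_apply]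
  have hm : Measurable fun (r : Fin K → ℂ) j => r (σ j) :=
    measurable_pi_lambda _ fun j => measurable_pi_apply _
  have : ∀ _ : Fin M, IsProbabilityMeasure ((complexGaussianVec K 1).map fun r j => r (σ j)) :=
    fun _ => Measure.isProbabilityMeasure_map hm.aemeasurable
  rw [rayleigh, Measure.pi_map_pi (μ := fun _ : Fin M => complexGaussianVec K 1)
    (f := fun _ r j => r (σ j)) (fun _ => hm.aemeasurable), h1]

/-- Permuting the columns of `h` permutes rows and columns of the Gram matrix, and hence of its
inverse. As the Rayleigh law is invariant under such permutations, the noise levels are identically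
distributed. -/
lemma zfError_perm (σ : Equiv.Perm (Fin K)) (h : Fin M → Fin K → ℂ) (k : Fin K) :
    zfError (fun i j => h i (σ j)) k = zfError h (σ k) := by
  have : (Matrix.of fun i j => h i (σ j))ᴴ * (Matrix.of fun i j => h i (σ j))
      = ((Matrix.of h)ᴴ * Matrix.of h).submatrix σ σ := by
    ext a b
    simp [Matrix.mul_apply]
  rw [zfError, zfError, this, inv_submatrix_equiv, submatrix_apply]

/-- The error levels of zero forcing are identically distributed. -/
lemma rayleigh_map_zfError (k l : Fin K) :
    (rayleigh M K).map (fun h => zfError h k) = (rayleigh M K).map (fun h => zfError h l) := by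
  conv_lhs => rw [← rayleigh_map_perm (Equiv.swap k l)]
  have hm : Measurable fun (h : Fin M → Fin K → ℂ) i j => h i (Equiv.swap k l j) :=
    measurable_pi_lambda _ fun i => measurable_pi_lambda _ fun j =>
      (measurable_pi_apply _).comp (measurable_pi_apply i)
  rw [Measure.map_map (by fun_prop) hm]
  congr 1
  ext h
  simp [zfError_perm]

end PseudoInverse

end QCI

namespace QCI

open Matrix

/-! ### Transfer to the sample space and conditioning on the channel matrix. -/

section Canonical

lemma cond_map {Ω E : Type*} [MeasurableSpace Ω] [MeasurableSpace E] {μ : Measure Ω} {T : Ω → E}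
    (hT : AEMeasurable T μ) {B : Set E} (hB : MeasurableSet B) :
    ProbabilityTheory.cond (μ.map T) B = (ProbabilityTheory.cond μ (T ⁻¹' B)).map T := by
  rw [ProbabilityTheory.cond, ProbabilityTheory.cond, Measure.map_smul, Measure.map_apply_of_aemeasurable hT hB,
    Measure.restrict_map_of_aemeasurable hT hB]

/-- Conditional mutual information only depends on the joint law. -/
lemma condMutualInfo_comp {Ω E α β γ : Type*} [MeasurableSpace Ω] [MeasurableSpace E]
    [MeasurableSpace α] [MeasurableSpace β] {μ : Measure Ω} {T : Ω → E} (hT : AEMeasurable T μ)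
    {X : E → α} {Y : E → β} {W : E → γ} (hX : Measurable X) (hY : Measurable Y)
    (hW : ∀ w, MeasurableSet (W ⁻¹' {w})) :
    condMutualInfo (fun ω => X (T ω)) (fun ω => Y (T ω)) (fun ω => W (T ω)) μ
      = condMutualInfo X Y W (μ.map T) := by
  refine tsum_congr fun w => ?_
  rw [Measure.map_apply_of_aemeasurable hT (hW w), cond_map hT (hW w)]
  have hT' : AEMeasurable T (ProbabilityTheory.cond μ (T ⁻¹' (W ⁻¹' {w}))) :=
    hT.mono_ac cond_absolutelyContinuous
  rw [mutualInfo, mutualInfo, AEMeasurable.map_map_of_aemeasurable hX.aemeasurable hT',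
    AEMeasurable.map_map_of_aemeasurable hY.aemeasurable hT',
    AEMeasurable.map_map_of_aemeasurable (hX.prodMk hY).aemeasurable hT']
  rfl

lemma mutualInfo_congr {Ω α β : Type*} [MeasurableSpace Ω] [MeasurableSpace α] [MeasurableSpace β]
    {μ : Measure Ω} {X X' : Ω → α} {Y Y' : Ω → β} (hX : X =ᵐ[μ] X') (hY : Y =ᵐ[μ] Y') :
    mutualInfo X Y μ = mutualInfo X' Y' μ := by
  rw [mutualInfo, mutualInfo, Measure.map_congr hX, Measure.map_congr hY,
    Measure.map_congr (hX.prodMk hY)]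

/-- The values of the random variables `(x, n, H, w, v, u)` of a scheme. -/
abbrev Sample (M K : ℕ) : Type :=
  (Fin K → ℂ) × (Fin M → ℂ) × (Fin M → Fin K → ℂ) × (Fin K → ℂ) × (Fin K → ℂ) × (Fin K → ℂ)

/-- The law of `(x, n, H, w, v, u)` when `H` has law `η`. -/
noncomputable def sampleLaw (M K : ℕ) (σ : ℝ≥0) (η : Measure (Fin M → Fin K → ℂ)) :
    Measure (Sample M K) :=
  (complexGaussianVec K 1).prod ((complexGaussianVec M σ).prod
    (η.prod ((complexGaussianVec K 1).prod ((complexGaussianVec K 1).prod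
      (complexGaussianVec K 1)))))

instance isProbabilityMeasure_sampleLaw (M K : ℕ) (σ : ℝ≥0) (η : Measure (Fin M → Fin K → ℂ))
    [IsProbabilityMeasure η] : IsProbabilityMeasure (sampleLaw M K σ η) := by
  unfold sampleLaw; infer_instance

/-- An event about `H` alone is a box constraining a single factor, so conditioning leaves the five
other factors Gaussian and independent of `H` and of each other. -/
lemma cond_sampleLaw {M K : ℕ} (σ : ℝ≥0) (η : Measure (Fin M → Fin K → ℂ)) [IsProbabilityMeasure η]
    (B : Set (Fin M → Fin K → ℂ)) :
    ProbabilityTheory.cond (sampleLaw M K σ η) ((fun ω : Sample M K => ω.2.2.1) ⁻¹' B)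
      = sampleLaw M K σ (ProbabilityTheory.cond η B) := by
  have hset : (fun ω : Sample M K => ω.2.2.1) ⁻¹' B
      = Set.univ ×ˢ (Set.univ ×ˢ (B ×ˢ Set.univ)) := by
    ext; simp
  rw [ProbabilityTheory.cond, ProbabilityTheory.cond, hset, sampleLaw, sampleLaw, Measure.prod_smul_left, Measure.prod_smul_right,
    Measure.prod_smul_right, Measure.prod_prod, Measure.prod_prod, Measure.prod_prod,
    ← Measure.prod_restrict, ← Measure.prod_restrict, ← Measure.prod_restrict]
  simp

variable {Ω : Type*} [MeasurableSpace Ω] {μ : Measure Ω} {M K m : ℕ}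

/-- The random variables of a scheme, bundled. -/
def Scheme.sample (S : Scheme μ M K m) (ω : Ω) : Sample M K :=
  (S.x ω, S.n ω, S.H ω, S.w ω, S.v ω, S.u ω)

/-- The copy of a scheme on its sample space. -/
def Scheme.canonical (S : Scheme μ M K m) :
    Scheme (sampleLaw M K S.noiseVar (rayleigh M K)) M K m where
  noiseVar := S.noiseVar
  noiseVar_pos := S.noiseVar_pos
  b := S.b
  b_mono := S.b_mono
  b_pos := S.b_pos
  b_eq_top_iff := S.b_eq_top_iff
  x ω := ω.1
  n ω := ω.2.1
  H ω := ω.2.2.1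
  w ω := ω.2.2.2.1
  v ω := ω.2.2.2.2.1
  u ω := ω.2.2.2.2.2
  hasLaw := ⟨aemeasurable_id, Measure.map_id⟩

end Canonical

/-! ### Independence of functions of the sample. -/

section Independence

variable {α β γ δ : Type*} [MeasurableSpace α] [MeasurableSpace β] [MeasurableSpace γ]
  [MeasurableSpace δ]

lemma indepFun_fst_snd (μ : Measure α) (ν : Measure β) [IsProbabilityMeasure μ]
    [IsProbabilityMeasure ν] : IndepFun Prod.fst Prod.snd (μ.prod ν) := by
  rw [indepFun_iff_map_prod_eq_prod_map_map (by fun_prop) (by fun_prop), Measure.map_fst_prod,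
    Measure.map_snd_prod]
  simp

/-- Peels one factor off a nested product; iterated, it reaches the innermost coordinate `u`. -/
lemma indepFun_prodMk_fst (μ : Measure α) (ν : Measure β) [IsProbabilityMeasure μ]
    [IsProbabilityMeasure ν] {f : β → γ} {g : β → δ} (hf : Measurable f) (hg : Measurable g)
    (h : IndepFun f g ν) :
    IndepFun (fun q : α × β => (q.1, f q.2)) (fun q : α × β => g q.2) (μ.prod ν) := by
  have := Measure.isProbabilityMeasure_map (μ := ν) hf.aemeasurable
  have := Measure.isProbabilityMeasure_map (μ := ν) hg.aemeasurable
  have h1 : (μ.prod ν).map (fun q : α × β => (q.1, f q.2)) = μ.prod (ν.map f) := by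
    conv_rhs => rw [← Measure.map_id (μ := μ), Measure.map_prod_map _ _ measurable_id hf]
    rfl
  have h2 : (μ.prod ν).map (fun q : α × β => g q.2) = ν.map g := by
    have : (fun q : α × β => g q.2) = g ∘ Prod.snd := rfl
    rw [this, ← Measure.map_map hg measurable_snd, Measure.map_snd_prod]
    simp
  rw [indepFun_iff_map_prod_eq_prod_map_map (by fun_prop) (by fun_prop), h1, h2]
  have h3 : (fun q : α × β => ((q.1, f q.2), g q.2))
      = MeasurableEquiv.prodAssoc.symm ∘ Prod.map id (fun b => (f b, g b)) := rfl
  rw [h3, ← Measure.map_map (MeasurableEquiv.measurable _) (by fun_prop),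
    ← Measure.map_prod_map _ _ measurable_id (by fun_prop), Measure.map_id,
    h.map_prod_eq_prod_map_map hf.aemeasurable hg.aemeasurable,
    (measurePreserving_prodAssoc μ (ν.map f) (ν.map g)).symm.map_eq]

variable {M K : ℕ} (σ : ℝ≥0) (η : Measure (Fin M → Fin K → ℂ)) [IsProbabilityMeasure η]

lemma indepFun_sample_u :
    IndepFun (fun ω : Sample M K => (ω.1, ω.2.1, ω.2.2.1, ω.2.2.2.1, ω.2.2.2.2.1))
      (fun ω => ω.2.2.2.2.2) (sampleLaw M K σ η) :=
  indepFun_prodMk_fst _ _ (f := fun q : (Fin M → ℂ) × (Fin M → Fin K → ℂ) × (Fin K → ℂ) ×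
      (Fin K → ℂ) × (Fin K → ℂ) => (q.1, q.2.1, q.2.2.1, q.2.2.2.1)) (g := fun q => q.2.2.2.2)
      (by fun_prop) (by fun_prop) <|
    indepFun_prodMk_fst _ _ (f := fun q : (Fin M → Fin K → ℂ) × (Fin K → ℂ) ×
      (Fin K → ℂ) × (Fin K → ℂ) => (q.1, q.2.1, q.2.2.1)) (g := fun q => q.2.2.2)
      (by fun_prop) (by fun_prop) <|
    indepFun_prodMk_fst _ _ (f := fun q : (Fin K → ℂ) × (Fin K → ℂ) × (Fin K → ℂ) =>
      (q.1, q.2.1)) (g := fun q => q.2.2) (by fun_prop) (by fun_prop) <|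
    indepFun_prodMk_fst _ _ (f := fun q : (Fin K → ℂ) × (Fin K → ℂ) => q.1) (g := fun q => q.2)
      (by fun_prop) (by fun_prop) <| indepFun_fst_snd _ _

lemma indepFun_sample_x :
    IndepFun (fun ω : Sample M K => ω.1) (fun ω => ω.2) (sampleLaw M K σ η) :=
  indepFun_fst_snd _ _

/-- Functions of `x` are independent of functions of `(n, H, w, v, u)`. -/
lemma indepFun_comp_x {f : (Fin K → ℂ) → γ} (hf : Measurable f) {g : Sample M K → δ}
    (hg : Measurable g) (hg' : ∀ ω, g ω = g (0, ω.2)) :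
    IndepFun (fun ω : Sample M K => f ω.1) g (sampleLaw M K σ η) := by
  have h := (indepFun_sample_x σ η).comp (ψ := fun q => g (0, q)) hf
    (hg.comp measurable_prodMk_left)
  have e : g = fun ω : Sample M K => g (0, ω.2) := funext hg'
  rw [e]
  exact h

/-- Functions of `(x, n, H, w, v)` are independent of functions of `u`. -/
lemma indepFun_comp_u {f : Sample M K → γ} (hf : Measurable f) {g : (Fin K → ℂ) → δ}
    (hg : Measurable g)
    (hf' : ∀ ω, f ω = f (ω.1, ω.2.1, ω.2.2.1, ω.2.2.2.1, ω.2.2.2.2.1, 0)) :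
    IndepFun f (fun ω : Sample M K => g ω.2.2.2.2.2) (sampleLaw M K σ η) := by
  have h := (indepFun_sample_u σ η).comp
    (φ := fun q : (Fin K → ℂ) × (Fin M → ℂ) × (Fin M → Fin K → ℂ) × (Fin K → ℂ) × (Fin K → ℂ) =>
      f (q.1, q.2.1, q.2.2.1, q.2.2.2.1, q.2.2.2.2, 0)) (hf.comp (by fun_prop)) hg
  have e : f = fun ω : Sample M K => f (ω.1, ω.2.1, ω.2.2.1, ω.2.2.2.1, ω.2.2.2.2.1, 0) :=
    funext hf'
  rw [e]
  exact h

lemma measurePreserving_sample_x :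
    MeasurePreserving (fun ω : Sample M K => ω.1) (sampleLaw M K σ η) (complexGaussianVec K 1) :=
  measurePreserving_fst

lemma measurePreserving_sample_vu :
    MeasurePreserving (fun ω : Sample M K => ω.2.2.2.2) (sampleLaw M K σ η)
      ((complexGaussianVec K 1).prod (complexGaussianVec K 1)) :=
  measurePreserving_snd.comp (measurePreserving_snd.comp (measurePreserving_snd.comp
    measurePreserving_snd))

lemma measurePreserving_sample_xv :
    MeasurePreserving (fun ω : Sample M K => (ω.1, ω.2.2.2.2.1)) (sampleLaw M K σ η)
      ((complexGaussianVec K 1).prod (complexGaussianVec K 1)) :=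
  (MeasurePreserving.id _).prod (measurePreserving_fst.comp (measurePreserving_snd.comp
    (measurePreserving_snd.comp measurePreserving_snd)))

lemma measurePreserving_sample_u :
    MeasurePreserving (fun ω : Sample M K => ω.2.2.2.2.2) (sampleLaw M K σ η)
      (complexGaussianVec K 1) :=
  measurePreserving_snd.comp (measurePreserving_sample_vu σ η)

lemma measurePreserving_sample_H :
    MeasurePreserving (fun ω : Sample M K => ω.2.2.1) (sampleLaw M K σ η) η :=
  measurePreserving_fst.comp (measurePreserving_snd.comp measurePreserving_snd)

end Independence

/-! ### The power of the filtered noise. -/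

section SecondMoments

variable {Ω : Type*} [MeasurableSpace Ω] {μ : Measure Ω}

lemma memLp_two_of_lintegral {d : Ω → ℂ} (hd : Measurable d) {c : ℝ} (hc : 0 ≤ c)
    (h : ∫⁻ ω, ENNReal.ofReal (‖d ω‖ ^ 2) ∂μ = ENNReal.ofReal c) :
    MemLp d 2 μ ∧ ∫ ω, ‖d ω‖ ^ 2 ∂μ = c := by
  refine ⟨?_, ?_⟩
  · rw [memLp_two_iff_integrable_sq_norm hd.aestronglyMeasurable]
    refine ⟨(hd.norm.pow_const 2).aestronglyMeasurable, ?_⟩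
    rw [hasFiniteIntegral_iff_ofReal (ae_of_all _ fun _ => by positivity), h]
    exact ENNReal.ofReal_lt_top
  · rw [integral_eq_lintegral_of_nonneg_ae (ae_of_all _ fun _ => by positivity)
      (hd.norm.pow_const 2).aestronglyMeasurable, h, ENNReal.toReal_ofReal hc]

/-- A random vector with independent `CN(0, s)` components. -/
lemma moments_of_map_eq {ι : Type*} [Fintype ι] {s : ι → ℝ≥0} {X : Ω → ι → ℂ}
    (hX : MeasurePreserving X μ (Measure.pi fun i => complexGaussian (s i))) (i : ι) :
    MemLp (fun ω => X ω i) 2 μ ∧ ∫ ω, X ω i ∂μ = 0 ∧ ∫ ω, ‖X ω i‖ ^ 2 ∂μ = s i := by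
  have h : MeasurePreserving (fun ω => X ω i) μ (complexGaussian (s i)) :=
    (measurePreserving_eval (fun i => complexGaussian (s i)) i).comp hX
  refine ⟨(memLp_id_complexGaussian (s i)).comp_measurePreserving h, ?_, ?_⟩
  · rw [← integral_id_complexGaussian (s i), ← h.map_eq,
      integral_map h.measurable.aemeasurable (by fun_prop)]
  · rw [← integral_norm_sq_complexGaussian (s i), ← h.map_eq,
      integral_map h.measurable.aemeasurable (by fun_prop)]

lemma norm_sq_linear_complexGaussianVec (d : ℕ) (s : ℝ≥0) (c : Fin d → ℂ) :
    MemLp (fun n => ∑ j, c j * n j) 2 (complexGaussianVec d s) ∧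
      ∫ n, ∑ j, c j * n j ∂(complexGaussianVec d s) = 0 ∧
      ∫ n, ‖∑ j, c j * n j‖ ^ 2 ∂(complexGaussianVec d s) = s * ∑ j, ‖c j‖ ^ 2 := by
  have hm := moments_of_map_eq (X := fun n : Fin d → ℂ => n) (MeasurePreserving.id
    (Measure.pi fun _ : Fin d => complexGaussian s))
  have h2 : ∀ j, MemLp (fun n : Fin d → ℂ => c j * n j) 2 (complexGaussianVec d s) :=
    fun j => (hm j).1.const_mul _
  have h0 : ∀ j, ∫ n, c j * n j ∂(complexGaussianVec d s) = 0 := fun j => by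
    rw [integral_const_mul]
    exact (congrArg _ (hm j).2.1).trans (mul_zero _)
  refine ⟨memLp_finsetSum _ fun j _ => h2 j, ?_, ?_⟩
  · rw [integral_finsetSum _ fun j _ => (h2 j).integrable (by norm_num)]
    exact Finset.sum_eq_zero fun j _ => h0 j
  · have hind : iIndepFun (fun j (n : Fin d → ℂ) => c j * n j) (complexGaussianVec d s) :=
      iIndepFun_pi (X := fun j (z : ℂ) => c j * z) fun j => by fun_prop
    rw [integral_norm_sq_sum (fun j => by fun_prop) h2 hind h0, Finset.mul_sum]
    refine Finset.sum_congr rfl fun j _ => ?_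
    simp_rw [norm_mul, mul_pow]
    rw [integral_const_mul, mul_comm]
    exact congrArg (· * _) (hm j).2.2

lemma lintegral_norm_sq_linear {β : Type*} [MeasurableSpace β] {d : ℕ} (s : ℝ≥0) (c : Fin d → ℂ)
    (ν : Measure β) [IsProbabilityMeasure ν] {Y : β → ℂ} (hYm : Measurable Y) (hY : MemLp Y 2 ν)
    {r : ℝ} (hYr : ∫ b, ‖Y b‖ ^ 2 ∂ν = r) :
    ∫⁻ q, ENNReal.ofReal (‖∑ j, c j * q.1 j + Y q.2‖ ^ 2) ∂((complexGaussianVec d s).prod ν)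
      = ENNReal.ofReal (s * ∑ j, ‖c j‖ ^ 2 + r) := by
  obtain ⟨h2, h0, hs⟩ := norm_sq_linear_complexGaussianVec d s c
  have hX2 : MemLp (fun q : (Fin d → ℂ) × β => ∑ j, c j * q.1 j) 2
      ((complexGaussianVec d s).prod ν) := h2.comp_measurePreserving measurePreserving_fst
  have hY2 : MemLp (fun q : (Fin d → ℂ) × β => Y q.2) 2
      ((complexGaussianVec d s).prod ν) := hY.comp_measurePreserving measurePreserving_snd
  have h1 := ofReal_integral_eq_lintegral_ofReal (hX2.add hY2).integrable_norm_sq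
    (ae_of_all _ fun _ => by positivity)
  simp only [Pi.add_apply] at h1
  rw [← h1]
  congr 1
  have := integral_norm_sq_add hX2 hY2 ((indepFun_fst_snd (complexGaussianVec d s) ν).comp
    (φ := fun n : Fin d → ℂ => ∑ j, c j * n j) (by fun_prop) hYm)
    (by rw [integral_fun_fst (f := fun n : Fin d → ℂ => ∑ j, c j * n j), h0, smul_zero])
  rw [this, integral_fun_fst (f := fun n : Fin d → ℂ => ‖∑ j, c j * n j‖ ^ 2),
    integral_fun_snd (f := fun b : β => ‖Y b‖ ^ 2), hs, hYr]
  simp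

/-- The power of the noise after a linear filter that depends on the channel matrix, plus artificial
noise whose level depends on the channel matrix. -/
lemma lintegral_filtered_noise {M K : ℕ} (σ : ℝ≥0) (η : Measure (Fin M → Fin K → ℂ))
    [IsProbabilityMeasure η] {c : (Fin M → Fin K → ℂ) → Fin M → ℂ} (hc : Measurable c)
    {β : (Fin M → Fin K → ℂ) → ℝ} (hβ : Measurable β) (k : Fin K) :
    ∫⁻ ω, ENNReal.ofReal (‖∑ j, c ω.2.2.1 j * ω.2.1 j + (β ω.2.2.1 : ℂ) * ω.2.2.2.1 k‖ ^ 2)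
        ∂(sampleLaw M K σ η)
      = ∫⁻ h, ENNReal.ofReal (σ * ∑ j, ‖c h j‖ ^ 2 + β h ^ 2) ∂η := by
  have hcj : ∀ j, Measurable fun h => c h j := fun j => (measurable_pi_apply j).comp hc
  have hF : Measurable fun q : (Fin M → ℂ) × (Fin M → Fin K → ℂ) × (Fin K → ℂ) × (Fin K → ℂ) ×
      (Fin K → ℂ) => ENNReal.ofReal
        (‖∑ j, c q.2.1 j * q.1 j + (β q.2.1 : ℂ) * q.2.2.1 k‖ ^ 2) := by fun_prop
  rw [sampleLaw, measurePreserving_snd.lintegral_comp hF, lintegral_prod _ hF.aemeasurable]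
  have h1 : ∀ n : Fin M → ℂ, ∫⁻ q, ENNReal.ofReal
      (‖∑ j, c q.1 j * n j + (β q.1 : ℂ) * q.2.1 k‖ ^ 2) ∂(η.prod ((complexGaussianVec K 1).prod
        ((complexGaussianVec K 1).prod (complexGaussianVec K 1))))
      = ∫⁻ h, ∫⁻ r, ENNReal.ofReal (‖∑ j, c h j * n j + (β h : ℂ) * r.1 k‖ ^ 2)
        ∂((complexGaussianVec K 1).prod ((complexGaussianVec K 1).prod (complexGaussianVec K 1)))
        ∂η := fun n => lintegral_prod _ (hF.comp measurable_prodMk_left).aemeasurable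
  simp_rw [h1]
  -- With `h` outermost, the filter coefficients are constants in the inner Gaussian integral.
  rw [lintegral_lintegral_swap]
  · refine lintegral_congr fun h => ?_
    have hm := moments_of_map_eq (X := fun n : Fin K → ℂ => n) (MeasurePreserving.id
      (Measure.pi fun _ : Fin K => complexGaussian 1)) k
    have hY : MemLp (fun r : (Fin K → ℂ) × (Fin K → ℂ) × (Fin K → ℂ) => (β h : ℂ) * r.1 k) 2
        ((complexGaussianVec K 1).prod ((complexGaussianVec K 1).prod
          (complexGaussianVec K 1))) :=
      (hm.1.comp_measurePreserving measurePreserving_fst).const_mul _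
    rw [← lintegral_norm_sq_linear σ (c h) _ (by fun_prop) hY (r := β h ^ 2),
      lintegral_prod _ (by fun_prop)]
    simp_rw [norm_mul, mul_pow]
    rw [integral_const_mul, integral_fun_fst (f := fun n : Fin K → ℂ => ‖n k‖ ^ 2)]
    have : ∫ n, ‖n k‖ ^ 2 ∂(complexGaussianVec K 1) = 1 := hm.2.2.trans NNReal.coe_one
    simp [this]
  · refine (Measurable.lintegral_prod_right ?_).aemeasurable
    fun_prop

end SecondMoments

end QCI

namespace QCI

open Matrix

/-! ### The quantizer and its cells. -/

section Quantizer

variable {J : ℕ} (b : Fin J → ℝ≥0∞)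

lemma ofReal_le_ceilGrid (a : ℝ) : ENNReal.ofReal a ≤ ceilGrid b a :=
  le_iInf₂ fun _ h => h

lemma measurable_ceilGrid : Measurable (ceilGrid b) := by
  unfold ceilGrid
  refine Measurable.iInf fun j => ?_
  have : (fun a : ℝ => ⨅ _ : ENNReal.ofReal a ≤ b j, b j)
      = fun a => if ENNReal.ofReal a ≤ b j then b j else ∞ := by
    ext a
    split_ifs with h <;> simp [h]
  rw [this]
  exact Measurable.ite (measurableSet_le ENNReal.measurable_ofReal measurable_const)
    measurable_const measurable_const

lemma ceilGrid_mem_range (hb : ∃ j, b j = ∞) (a : ℝ) : ceilGrid b a ∈ Set.range b := by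
  classical
  obtain ⟨j₀, hj₀⟩ := hb
  obtain ⟨j, hj, hmin⟩ := (Finset.univ.filter fun j => ENNReal.ofReal a ≤ b j).exists_min_image b
    ⟨j₀, by simp [hj₀]⟩
  simp only [Finset.mem_filter, Finset.mem_univ, true_and] at hj hmin
  exact ⟨j, le_antisymm (le_iInf₂ hmin) (iInf₂_le j hj)⟩

lemma ceilGrid_eq_of_mem_cell (hb : Monotone b) {a : ℝ} {j : Fin J} (h : a ∈ cell b j) :
    ceilGrid b a = b j := by
  refine le_antisymm (iInf₂_le j h.2) (le_iInf₂ fun i hi => ?_)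
  by_contra hlt
  rw [not_le] at hlt
  have hij : i < j := by
    by_contra hij
    exact absurd (hb (not_lt.1 hij)) (not_le.2 hlt)
  exact absurd hi (not_le.2 (h.1 i hij))

lemma exists_mem_cell (hb : ∃ j, b j = ∞) (a : ℝ) : ∃ j, a ∈ cell b j := by
  classical
  obtain ⟨j₀, hj₀⟩ := hb
  have hne : (Finset.univ.filter fun j => ENNReal.ofReal a ≤ b j).Nonempty := ⟨j₀, by simp [hj₀]⟩
  refine ⟨_, fun i hi => ?_, (Finset.mem_filter.1 (Finset.min'_mem _ hne)).2⟩
  by_contra h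
  exact absurd (Finset.min'_le _ i (by simpa using h)) (not_le.2 hi)

lemma cell_disjoint {i j : Fin J} (hij : i < j) {a : ℝ} (hi : a ∈ cell b i) : a ∉ cell b j :=
  fun hj => absurd hi.2 (not_le.2 (hj.1 i hij))

lemma measurableSet_cell (j : Fin J) : MeasurableSet (cell b j) := by
  have : cell b j = (⋂ i, ⋂ _ : i < j, {a : ℝ | b i < ENNReal.ofReal a})
      ∩ {a : ℝ | ENNReal.ofReal a ≤ b j} := by
    ext a; simp [cell]
  rw [this]
  refine MeasurableSet.inter (MeasurableSet.iInter fun i => MeasurableSet.iInter fun _ => ?_) ?_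
  · exact measurableSet_lt measurable_const ENNReal.measurable_ofReal
  · exact measurableSet_le ENNReal.measurable_ofReal measurable_const

end Quantizer

/-! ### The scheme as a function of the sample: measurability and the conditional noise. -/

namespace Scheme

variable {Ω : Type*} [MeasurableSpace Ω] {μ : Measure Ω} {M K m : ℕ} (S : Scheme μ M K m)

/-- The quantized noise levels, as a function of the channel matrix. -/
noncomputable def noiseLevel (h : Fin M → Fin K → ℂ) : Fin K → ℝ≥0∞ :=
  fun k => ceilGrid S.b (S.noiseVar * zfError h k)

lemma a_eq (k : Fin K) (ω : Ω) : S.a k ω = S.noiseVar * zfError (S.H ω) k := by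
  rw [a, A, Matrix.smul_apply, smul_eq_mul, Complex.re_ofReal_mul]
  rfl

lemma A1'_eq (ω : Ω) : S.A1' ω = S.noiseLevel (S.H ω) := by
  ext k
  rw [A1', noiseLevel, a_eq]

lemma exists_b_eq_top : ∃ j, S.b j = ∞ := ⟨_, (S.b_eq_top_iff _).2 rfl⟩

lemma measurable_noiseLevel : Measurable S.noiseLevel :=
  measurable_pi_lambda _ fun k => (measurable_ceilGrid S.b).comp (by fun_prop)

lemma noiseLevel_mem (h : Fin M → Fin K → ℂ) :
    S.noiseLevel h ∈ Fintype.piFinset fun _ : Fin K => Finset.univ.image S.b := by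
  rw [Fintype.mem_piFinset]
  intro k
  obtain ⟨j, hj⟩ := ceilGrid_mem_range S.b S.exists_b_eq_top (S.noiseVar * zfError h k)
  exact Finset.mem_image.2 ⟨j, Finset.mem_univ _, hj⟩

lemma xTilde_apply {ω : Ω} (h : IsUnit (((Matrix.of (S.H ω))ᴴ * Matrix.of (S.H ω)).det))
    (k : Fin K) : S.xTilde ω k = S.x ω k + ∑ j, zfFilter (S.H ω) k j * S.n ω j := by
  have : S.xTilde ω = S.x ω + zfFilter (S.H ω) *ᵥ S.n ω := by
    have h1 : S.xTilde ω = zfFilter (S.H ω) *ᵥ (Matrix.of (S.H ω) *ᵥ S.x ω + S.n ω) := rfl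
    rw [h1, mulVec_add, mulVec_mulVec, zfFilter_mul _ h, one_mulVec]
  rw [this, Pi.add_apply]
  rfl

/-- Functions of the quantized noise levels are measurable, as there are finitely many levels. -/
lemma measurable_comp_noiseLevel {β : Type*} [MeasurableSpace β]
    (f : (Fin K → ℝ≥0∞) → β) : Measurable fun h => f (S.noiseLevel h) :=
  (SimpleFunc.map f ⟨S.noiseLevel, fun w => S.measurable_noiseLevel (measurableSet_singleton w),
    (Fintype.piFinset fun _ : Fin K => Finset.univ.image S.b).finite_toSet.subset
      (Set.range_subset_iff.2 S.noiseLevel_mem)⟩).measurable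

section CanonicalMeasurability

lemma measurable_canonical_A1' : Measurable S.canonical.A1' := by
  have : S.canonical.A1' = fun ω => S.noiseLevel ω.2.2.1 := funext fun ω => S.canonical.A1'_eq ω
  rw [this]
  exact S.measurable_noiseLevel.comp (by fun_prop)

lemma measurable_canonical_comp_A1' {β : Type*} [MeasurableSpace β] (f : (Fin K → ℝ≥0∞) → β) :
    Measurable fun ω => f (S.canonical.A1' ω) := by
  have : S.canonical.A1' = fun ω => S.noiseLevel ω.2.2.1 := funext fun ω => S.canonical.A1'_eq ω
  simp only [this]
  exact (S.measurable_comp_noiseLevel f).comp (g := fun h => f (S.noiseLevel h)) (by fun_prop)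

lemma measurable_canonical_xHat : Measurable S.canonical.xHat := by
  refine measurable_pi_lambda _ fun k => ?_
  refine Measurable.ite ?_ measurable_const ?_
  · exact (measurableSet_singleton ∞).preimage
      ((measurable_pi_apply k).comp S.measurable_canonical_A1')
  · refine Measurable.add ?_ (Measurable.mul ?_ ?_)
    · have : (fun ω => S.canonical.xTilde ω k) = fun ω : Sample M K =>
          ∑ j, zfFilter ω.2.2.1 k j * (∑ i, ω.2.2.1 j i * ω.1 i + ω.2.1 j) := rfl
      rw [this]
      fun_prop
    · refine Complex.measurable_ofReal.comp (Measurable.sqrt ?_)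
      refine Measurable.sub (ENNReal.measurable_toReal.comp
        ((measurable_pi_apply k).comp S.measurable_canonical_A1')) ?_
      have : S.canonical.a k = fun ω : Sample M K => S.noiseVar * zfError ω.2.2.1 k :=
        funext fun ω => S.canonical.a_eq k ω
      rw [this]
      fun_prop
    · exact (measurable_pi_apply k).comp (by
        exact measurable_fst.comp (measurable_snd.comp (measurable_snd.comp measurable_snd)))

lemma measurable_canonical_xHatG : Measurable S.canonical.xHatG := by
  refine measurable_pi_lambda _ fun k => ?_
  refine Measurable.ite ?_ measurable_const ?_
  · exact (measurableSet_singleton ∞).preimage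
      ((measurable_pi_apply k).comp S.measurable_canonical_A1')
  · have h1 : Measurable fun ω => ((S.canonical.A1' ω) k).toReal := ENNReal.measurable_toReal.comp
      ((measurable_pi_apply k).comp S.measurable_canonical_A1')
    have hx : Measurable fun ω => S.canonical.x ω k :=
      (measurable_pi_apply k).comp measurable_fst
    have hv : Measurable fun ω => S.canonical.v ω k :=
      (measurable_pi_apply k).comp (measurable_fst.comp
        (measurable_snd.comp (measurable_snd.comp (measurable_snd.comp measurable_snd))))
    fun_prop

lemma measurable_canonical_u : Measurable S.canonical.u :=
  measurable_snd.comp (measurable_snd.comp (measurable_snd.comp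
    (measurable_snd.comp measurable_snd)))

lemma measurable_canonical_z (φ : (Fin K → ℝ≥0∞) → Fin K → ℝ≥0) :
    Measurable (S.canonical.z φ) := by
  refine measurable_pi_lambda _ fun k => ?_
  refine Measurable.add (Measurable.mul ?_ ?_) ?_
  · exact S.measurable_canonical_comp_A1' fun w => ((φ w k : ℝ) : ℂ)
  · exact (measurable_pi_apply k).comp S.measurable_canonical_xHat
  · exact (measurable_pi_apply k).comp S.measurable_canonical_u

lemma measurable_canonical_zHatG (φ : (Fin K → ℝ≥0∞) → Fin K → ℝ≥0) :
    Measurable (S.canonical.zHatG φ) := by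
  refine measurable_pi_lambda _ fun k => ?_
  refine Measurable.add (Measurable.mul ?_ ?_) ?_
  · exact S.measurable_canonical_comp_A1' fun w => ((φ w k : ℝ) : ℂ)
  · exact (measurable_pi_apply k).comp S.measurable_canonical_xHatG
  · exact (measurable_pi_apply k).comp S.measurable_canonical_u

end CanonicalMeasurability

section Conditional

/-- The noise in an unerased component of the degraded zero-forcing estimate, given the quantized
noise levels. -/
noncomputable def zfNoise (w : Fin K → ℝ≥0∞) (k : Fin K) (ω : Sample M K) : ℂ :=
  if w k = ∞ then 0 else ∑ j, zfFilter ω.2.2.1 k j * ω.2.1 j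
    + (√((w k).toReal - S.noiseVar * zfError ω.2.2.1 k) : ℝ) * ω.2.2.2.1 k

lemma measurable_zfNoise (w : Fin K → ℝ≥0∞) (k : Fin K) : Measurable (S.zfNoise w k) := by
  unfold zfNoise
  split_ifs
  · fun_prop
  · refine Measurable.add (by fun_prop) (Measurable.mul (Complex.measurable_ofReal.comp
      (Measurable.sqrt (by fun_prop))) (by fun_prop))

variable (η : Measure (Fin M → Fin K → ℂ)) [IsProbabilityMeasure η]

/-- Given `H`, the filtered noise has variance `a_k` and the artificial noise adds `w k - a_k`. The
total `w k` is the same for all `H` in the level set, so averaging over `H` does not change it. -/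
lemma moments_zfNoise {w : Fin K → ℝ≥0∞}
    (hu : ∀ᵐ h ∂η, IsUnit (((Matrix.of h)ᴴ * Matrix.of h).det))
    (hw : ∀ᵐ h ∂η, S.noiseLevel h = w) (k : Fin K) :
    MemLp (S.zfNoise w k) 2 (sampleLaw M K S.noiseVar η) ∧
      ∫ ω, ‖S.zfNoise w k ω‖ ^ 2 ∂(sampleLaw M K S.noiseVar η) = (w k).toReal := by
  -- For an erased component both the noise and `ENNReal.toReal ∞` are zero.
  by_cases hk : w k = ∞
  · have : S.zfNoise w k = fun _ => 0 := by
      ext ω; simp [zfNoise, hk]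
    rw [this]
    simp [hk]
  refine memLp_two_of_lintegral (S.measurable_zfNoise w k) ENNReal.toReal_nonneg ?_
  simp only [zfNoise, if_neg hk]
  rw [lintegral_filtered_noise S.noiseVar η (c := fun h j => zfFilter h k j)
    (β := fun h => √((w k).toReal - S.noiseVar * zfError h k)) (by fun_prop)
    (Measurable.sqrt (by fun_prop)) k]
  have : ∀ᵐ h ∂η, ENNReal.ofReal (S.noiseVar * ∑ j, ‖zfFilter h k j‖ ^ 2
      + √((w k).toReal - S.noiseVar * zfError h k) ^ 2) = ENNReal.ofReal (w k).toReal := by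
    filter_upwards [hu, hw] with h h1 h2
    -- Rounding up keeps the radicand `w k - a_k` non-negative, so the square root is not truncated.
    have h3 := ofReal_le_ceilGrid S.b (S.noiseVar * zfError h k)
    have h4 : ceilGrid S.b (S.noiseVar * zfError h k) = w k := congrFun h2 k
    rw [h4] at h3
    have h5 : S.noiseVar * zfError h k ≤ (w k).toReal := (ENNReal.ofReal_le_iff_le_toReal hk).1 h3
    rw [Real.sq_sqrt (by linarith), sum_norm_sq_zfFilter h h1]
    congr 1
    ring
  rw [lintegral_congr_ae this]
  simp

lemma canonical_xHat_ae_eq {w : Fin K → ℝ≥0∞}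
    (hu : ∀ᵐ h ∂η, IsUnit (((Matrix.of h)ᴴ * Matrix.of h).det))
    (hw : ∀ᵐ h ∂η, S.noiseLevel h = w) :
    S.canonical.xHat =ᵐ[sampleLaw M K S.noiseVar η]
      fun ω k => if w k = ∞ then 0 else ω.1 k + S.zfNoise w k ω := by
  have hH := (measurePreserving_sample_H S.noiseVar η).quasiMeasurePreserving
  filter_upwards [hH.ae hu, hH.ae hw] with ω h1 h2
  ext k
  have h3 : S.canonical.A1' ω = w := (S.canonical.A1'_eq ω).trans h2
  rw [xHat, h3]
  split_ifs with hk
  · rfl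
  · rw [S.canonical.xTilde_apply h1, a_eq, zfNoise, if_neg hk, add_assoc]
    rfl

lemma canonical_A1'_ae_eq {w : Fin K → ℝ≥0∞} (hw : ∀ᵐ h ∂η, S.noiseLevel h = w) :
    ∀ᵐ ω ∂(sampleLaw M K S.noiseVar η), S.canonical.A1' ω = w := by
  have hH := (measurePreserving_sample_H S.noiseVar η).quasiMeasurePreserving
  filter_upwards [hH.ae hw] with ω h2
  exact (S.canonical.A1'_eq ω).trans h2

end Conditional

end Scheme

end QCI

namespace QCI

/-! ### Gaussian inputs over Gaussian channels. -/

section GaussianChannel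

variable {Ω : Type*} [MeasurableSpace Ω] {μ : Measure Ω} [IsProbabilityMeasure μ]

lemma moments_channel {X N : Ω → ℂ} {p t : ℝ} (φ : ℝ) (hX : MemLp X 2 μ)
    (hXp : ∫ ω, ‖X ω‖ ^ 2 ∂μ = p) (hN : MemLp N 2 μ) (hN0 : ∫ ω, N ω ∂μ = 0)
    (hNt : ∫ ω, ‖N ω‖ ^ 2 ∂μ = t) (hind : IndepFun X N μ) :
    MemLp (fun ω => (φ : ℂ) * X ω + N ω) 2 μ ∧
      ∫ ω, ‖(φ : ℂ) * X ω + N ω‖ ^ 2 ∂μ = t + φ ^ 2 * p := by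
  refine ⟨(hX.const_mul _).add hN, ?_⟩
  have := integral_norm_sq_add hN (hX.const_mul (φ : ℂ))
    (hind.symm.comp measurable_id (measurable_const_mul (φ : ℂ))) hN0
  simp_rw [add_comm ((φ : ℂ) * _)]
  rw [this, hNt]
  simp_rw [norm_mul, mul_pow]
  rw [integral_const_mul, hXp]
  simp

/-- The mutual information over parallel additive Gaussian noise channels with Gaussian inputs. -/
lemma mutualInfo_gaussian_channel {ι : Type*} [Fintype ι] {X N : Ω → ι → ℂ} (φ : ι → ℝ)
    {t p : ι → ℝ≥0} (ht : ∀ k, t k ≠ 0)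
    (hX : MeasurePreserving X μ (Measure.pi fun k => complexGaussian (p k)))
    (hN : MeasurePreserving N μ (Measure.pi fun k => complexGaussian (t k)))
    (hind : IndepFun X N μ) :
    mutualInfo X (fun ω k => (φ k : ℂ) * X ω k + N ω k) μ
      = ENNReal.ofReal (∑ k, Real.logb 2 ((t k + φ k ^ 2 * p k) / t k)) := by
  have hnn : ∀ k, 0 ≤ φ k ^ 2 := fun k => sq_nonneg _
  have hs : ∀ k, ((t k + ⟨φ k ^ 2, hnn k⟩ * p k : ℝ≥0) : ℝ) = t k + φ k ^ 2 * p k := fun k => by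
    push_cast; rfl
  simp_rw [← hs]
  have mX := moments_of_map_eq hX
  have mN := moments_of_map_eq hN
  have mZ := fun k => moments_channel (φ k) (mX k).1 (mX k).2.2 (mN k).1 (mN k).2.1 (mN k).2.2
    (hind.comp (measurable_pi_apply k) (measurable_pi_apply k))
  have hXm := hX.measurable
  have hNm := hN.measurable
  -- With Gaussian input and Gaussian noise the two extremal bounds coincide.
  refine le_antisymm (mutualInfo_le_of_gaussian_noise μ hXm hNm φ (p := p) ht hs ?_
    (fun k => (mX k).1) (fun k => (mX k).2.2)) ?_
  · rw [hind.map_prod_eq_prod_map_map hXm.aemeasurable hNm.aemeasurable, hN.map_eq]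
  · refine le_mutualInfo_of_gaussian_input μ hXm (by fun_prop) φ (p := p) ht hs hX.map_eq ?_
      (fun k => (mZ k).1) ?_ (fun k => (mZ k).2.trans (hs k).symm)
    · intro k
      simpa using (mN k).1
    · intro k
      simpa using (mN k).2.2

end GaussianChannel

/-! ### The rates of a single component. -/

section Rates

/-- The rate spent on the description of a component with noise level `w` and fading `f`. -/
noncomputable def relayRate (w : ℝ≥0∞) (f : ℝ≥0) : ℝ :=
  if w = ∞ then 0 else Real.logb 2 (1 + f ^ 2 * (1 + w.toReal))

/-- The rate conveyed about a component of the input with noise level `w` and fading `f`. -/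
noncomputable def sourceRate (w : ℝ≥0∞) (f : ℝ≥0) : ℝ :=
  if w = ∞ then 0 else Real.logb 2 ((1 + f ^ 2 * (1 + w.toReal)) / (1 + f ^ 2 * w.toReal))

lemma relayRate_nonneg (w : ℝ≥0∞) (f : ℝ≥0) : 0 ≤ relayRate w f := by
  unfold relayRate
  split_ifs
  · rfl
  · refine Real.logb_nonneg one_lt_two ?_
    have : 0 ≤ (f : ℝ) ^ 2 * (1 + w.toReal) := by positivity
    linarith

lemma sourceRate_nonneg (w : ℝ≥0∞) (f : ℝ≥0) : 0 ≤ sourceRate w f := by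
  unfold sourceRate
  split_ifs
  · rfl
  · refine Real.logb_nonneg one_lt_two ?_
    rw [one_le_div (by positivity)]
    have : (f : ℝ) ^ 2 * w.toReal ≤ f ^ 2 * (1 + w.toReal) := by
      gcongr
      linarith
    linarith

/-- The power of an unerased component of the estimate with noise level `w`. -/
noncomputable def estimatePower (w : ℝ≥0∞) : ℝ≥0 := if w = ∞ then 0 else 1 + w.toNNReal

lemma relayRate_eq (w : ℝ≥0∞) (f : ℝ≥0) :
    relayRate w f = Real.logb 2 ((1 + f ^ 2 * estimatePower w) / 1) := by
  rw [relayRate, estimatePower]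
  split_ifs
  · simp
  · simp [ENNReal.toReal]

/-- The fading of a component, set to zero if the component is erased. -/
noncomputable def activeFading (w : ℝ≥0∞) (f : ℝ≥0) : ℝ≥0 := if w = ∞ then 0 else f

/-- Brings the rate into the form of a channel from `x k` with fading `f` and effective noise power
`f² w + 1`. An erased component is a channel with zero fading. -/
lemma sourceRate_eq (w : ℝ≥0∞) (f : ℝ≥0) :
    sourceRate w f = Real.logb 2
      (((activeFading w f ^ 2 * w.toNNReal + 1 : ℝ≥0) + (activeFading w f : ℝ) ^ 2 * (1 : ℝ≥0))
        / (activeFading w f ^ 2 * w.toNNReal + 1 : ℝ≥0)) := by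
  rw [sourceRate, activeFading]
  split_ifs
  · simp
  · push_cast
    rw [ENNReal.toReal]
    congr 2 <;> ring

end Rates

/-! ### The four mutual informations at fixed quantized noise levels. -/

namespace Scheme

variable {Ω : Type*} [MeasurableSpace Ω] {μ : Measure Ω} {M K m : ℕ} (S : Scheme μ M K m)
  (η : Measure (Fin M → Fin K → ℂ)) [IsProbabilityMeasure η] {w : Fin K → ℝ≥0∞}
  (φ : (Fin K → ℝ≥0∞) → Fin K → ℝ≥0)

lemma canonical_xHatG_ae_eq (hw : ∀ᵐ h ∂η, S.noiseLevel h = w) :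
    S.canonical.xHatG =ᵐ[sampleLaw M K S.noiseVar η]
      fun ω k => if w k = ∞ then 0 else ω.1 k + (√(w k).toReal : ℝ) * ω.2.2.2.2.1 k := by
  filter_upwards [S.canonical_A1'_ae_eq η hw] with ω h
  ext k
  rw [xHatG, h]
  rfl

lemma canonical_zHatG_ae_eq (hw : ∀ᵐ h ∂η, S.noiseLevel h = w) :
    S.canonical.zHatG φ =ᵐ[sampleLaw M K S.noiseVar η] fun ω k => (φ w k : ℝ)
      * (if w k = ∞ then 0 else ω.1 k + (√(w k).toReal : ℝ) * ω.2.2.2.2.1 k)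
        + ω.2.2.2.2.2 k := by
  filter_upwards [S.canonical_A1'_ae_eq η hw, S.canonical_xHatG_ae_eq η hw] with ω h h2
  ext k
  rw [zHatG, h, h2]
  rfl

lemma canonical_z_ae_eq (hu : ∀ᵐ h ∂η, IsUnit (((Matrix.of h).conjTranspose * Matrix.of h).det))
    (hw : ∀ᵐ h ∂η, S.noiseLevel h = w) :
    S.canonical.z φ =ᵐ[sampleLaw M K S.noiseVar η] fun ω k => (φ w k : ℝ)
      * (if w k = ∞ then 0 else ω.1 k + S.zfNoise w k ω) + ω.2.2.2.2.2 k := by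
  filter_upwards [S.canonical_A1'_ae_eq η hw, S.canonical_xHat_ae_eq η hu hw] with ω h h2
  ext k
  rw [z, h, h2]
  rfl

lemma indepFun_x_zfNoise (k : Fin K) :
    IndepFun (fun ω : Sample M K => ω.1 k) (S.zfNoise w k) (sampleLaw M K S.noiseVar η) :=
  indepFun_comp_x S.noiseVar η (measurable_pi_apply k) (S.measurable_zfNoise w k) fun _ => rfl

lemma moments_x (k : Fin K) : MemLp (fun ω : Sample M K => ω.1 k) 2 (sampleLaw M K S.noiseVar η) ∧
    ∫ ω : Sample M K, ω.1 k ∂(sampleLaw M K S.noiseVar η) = 0 ∧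
      ∫ ω : Sample M K, ‖ω.1 k‖ ^ 2 ∂(sampleLaw M K S.noiseVar η) = (1 : ℝ≥0) :=
  moments_of_map_eq (s := fun _ => 1) (measurePreserving_sample_x S.noiseVar η) k

lemma moments_u (k : Fin K) :
    MemLp (fun ω : Sample M K => ω.2.2.2.2.2 k) 2 (sampleLaw M K S.noiseVar η) ∧
    ∫ ω : Sample M K, ω.2.2.2.2.2 k ∂(sampleLaw M K S.noiseVar η) = 0 ∧
      ∫ ω : Sample M K, ‖ω.2.2.2.2.2 k‖ ^ 2 ∂(sampleLaw M K S.noiseVar η) = (1 : ℝ≥0) :=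
  moments_of_map_eq (s := fun _ => 1) (measurePreserving_sample_u S.noiseVar η) k

/-- The noise `u` is Gaussian while the input `x̂` has only its power under control, which suffices
for the capacity bound. -/
lemma mutualInfo_xHat_z_le
    (hu : ∀ᵐ h ∂η, IsUnit (((Matrix.of h).conjTranspose * Matrix.of h).det))
    (hw : ∀ᵐ h ∂η, S.noiseLevel h = w) :
    mutualInfo S.canonical.xHat (S.canonical.z φ) (sampleLaw M K S.noiseVar η)
      ≤ ENNReal.ofReal (∑ k, relayRate (w k) (φ w k)) := by
  rw [mutualInfo_congr (S.canonical_xHat_ae_eq η hu hw) (S.canonical_z_ae_eq η φ hu hw)]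
  simp_rw [relayRate_eq]
  have hm : Measurable fun (ω : Sample M K) k => if w k = ∞ then 0 else ω.1 k + S.zfNoise w k ω := by
    refine measurable_pi_lambda _ fun k => ?_
    have := S.measurable_zfNoise w k
    split_ifs <;> fun_prop
  have hmom : ∀ k, MemLp (fun ω : Sample M K => if w k = ∞ then 0 else ω.1 k + S.zfNoise w k ω) 2
      (sampleLaw M K S.noiseVar η) ∧ ∫ ω : Sample M K,
        ‖if w k = ∞ then 0 else ω.1 k + S.zfNoise w k ω‖ ^ 2 ∂(sampleLaw M K S.noiseVar η)
        = estimatePower (w k) := by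
    intro k
    by_cases hk : w k = ∞
    · simp [hk, estimatePower]
    · simp only [if_neg hk, estimatePower]
      obtain ⟨h1, h2, h3⟩ := S.moments_x η k
      obtain ⟨h4, h5⟩ := S.moments_zfNoise η hu hw k
      refine ⟨h1.add h4, ?_⟩
      rw [integral_norm_sq_add h1 h4 (S.indepFun_x_zfNoise η k) h2, h3, h5]
      rfl
  refine mutualInfo_le_of_gaussian_noise (sampleLaw M K S.noiseVar η) (N := fun ω => ω.2.2.2.2.2)
    hm (by fun_prop) (fun k => (φ w k : ℝ)) (t := fun _ => 1)
    (s := fun k => 1 + φ w k ^ 2 * estimatePower (w k)) (p := fun k => estimatePower (w k))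
    (fun _ => one_ne_zero) (fun k => by push_cast; rfl) ?_ (fun k => (hmom k).1)
    (fun k => (hmom k).2) |>.trans_eq ?_
  · have hind := indepFun_comp_u S.noiseVar η hm measurable_id fun _ => rfl
    have h2 := hind.map_prod_eq_prod_map_map (hm.aemeasurable) (by fun_prop)
    refine h2.trans ?_
    congr 1
    exact (measurePreserving_sample_u S.noiseVar η).map_eq
  · simp

/-- The input `x̂_g` has independent Gaussian components, so the capacity bound is attained. -/
lemma mutualInfo_xHatG_zHatG (hw : ∀ᵐ h ∂η, S.noiseLevel h = w) :
    mutualInfo S.canonical.xHatG (S.canonical.zHatG φ) (sampleLaw M K S.noiseVar η)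
      = ENNReal.ofReal (∑ k, relayRate (w k) (φ w k)) := by
  rw [mutualInfo_congr (S.canonical_xHatG_ae_eq η hw) (S.canonical_zHatG_ae_eq η φ hw)]
  simp_rw [relayRate_eq]
  have hFm : ∀ k, Measurable fun p : ℂ × ℂ =>
      if w k = ∞ then 0 else p.1 + (√(w k).toReal : ℝ) * p.2 := fun k => by
    split_ifs <;> fun_prop
  have hm : Measurable fun (q : (Fin K → ℂ) × (Fin K → ℂ)) k =>
      if w k = ∞ then 0 else q.1 k + (√(w k).toReal : ℝ) * q.2 k := by
    refine measurable_pi_lambda _ fun k => ?_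
    split_ifs <;> fun_prop
  have hlaw : ((complexGaussianVec K 1).prod (complexGaussianVec K 1)).map
      (fun (q : (Fin K → ℂ) × (Fin K → ℂ)) k =>
        if w k = ∞ then 0 else q.1 k + (√(w k).toReal : ℝ) * q.2 k)
      = Measure.pi fun k => complexGaussian (estimatePower (w k)) := by
    refine (pi_prod_pi_map (fun _ : Fin K => complexGaussian 1) (fun _ : Fin K => complexGaussian 1)
      (fun k p => if w k = ∞ then 0 else p.1 + (√(w k).toReal : ℝ) * p.2) hFm).trans ?_
    congr 1
    ext1 k
    by_cases hk : w k = ∞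
    · simp [hk, estimatePower, complexGaussian_zero]
    · simp only [if_neg hk, estimatePower]
      have := complexGaussian_prod_map 1 1 1 √(w k).toReal
      rw [Real.sq_sqrt ENNReal.toReal_nonneg] at this
      simpa using this
  have hX : MeasurePreserving (fun (ω : Sample M K) k =>
      if w k = ∞ then 0 else ω.1 k + (√(w k).toReal : ℝ) * ω.2.2.2.2.1 k)
      (sampleLaw M K S.noiseVar η) (Measure.pi fun k => complexGaussian (estimatePower (w k))) :=
    (⟨hm, hlaw⟩ : MeasurePreserving _ _ _).comp (measurePreserving_sample_xv S.noiseVar η)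
  have hind : IndepFun (fun (ω : Sample M K) k =>
      if w k = ∞ then 0 else ω.1 k + (√(w k).toReal : ℝ) * ω.2.2.2.2.1 k)
      (fun ω => ω.2.2.2.2.2) (sampleLaw M K S.noiseVar η) :=
    indepFun_comp_u S.noiseVar η hX.measurable measurable_id fun _ => rfl
  have := mutualInfo_gaussian_channel (fun k => (φ w k : ℝ)) (t := fun _ => 1)
    (fun _ => one_ne_zero) hX (measurePreserving_sample_u S.noiseVar η) hind
  rw [NNReal.coe_one] at this
  exact this

/-- Seen from `x`, the scaled noise `n̂_g` and `u` merge into one Gaussian noise independent of `x`.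
-/
lemma mutualInfo_x_zHatG (hw : ∀ᵐ h ∂η, S.noiseLevel h = w) :
    mutualInfo S.canonical.x (S.canonical.zHatG φ) (sampleLaw M K S.noiseVar η)
      = ENNReal.ofReal (∑ k, sourceRate (w k) (φ w k)) := by
  rw [mutualInfo_congr (Filter.EventuallyEq.refl _ S.canonical.x)
    (S.canonical_zHatG_ae_eq η φ hw)]
  simp_rw [sourceRate_eq]
  set f : Fin K → ℝ≥0 := fun k => activeFading (w k) (φ w k) with hf
  have hN : MeasurePreserving (fun (ω : Sample M K) k =>
      ((f k * √(w k).toReal : ℝ) : ℂ) * ω.2.2.2.2.1 k + ((1 : ℝ) : ℂ) * ω.2.2.2.2.2 k)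
      (sampleLaw M K S.noiseVar η)
      (Measure.pi fun k => complexGaussian (f k ^ 2 * (w k).toNNReal + 1)) := by
    refine MeasurePreserving.comp (g := fun (q : (Fin K → ℂ) × (Fin K → ℂ)) k =>
      ((f k * √(w k).toReal : ℝ) : ℂ) * q.1 k + ((1 : ℝ) : ℂ) * q.2 k) ⟨by fun_prop, ?_⟩
      (measurePreserving_sample_vu S.noiseVar η)
    refine (pi_prod_pi_map (fun _ : Fin K => complexGaussian 1) (fun _ : Fin K => complexGaussian 1)
      (fun k p => ((f k * √(w k).toReal : ℝ) : ℂ) * p.1 + ((1 : ℝ) : ℂ) * p.2)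
      fun k => by fun_prop).trans ?_
    congr 1
    ext1 k
    rw [complexGaussian_prod_map]
    congr 1
    rw [mul_pow, Real.sq_sqrt ENNReal.toReal_nonneg, Real.toNNReal_mul (by positivity)]
    simp [Real.toNNReal_pow]
  have hind : IndepFun (fun ω : Sample M K => ω.1) (fun (ω : Sample M K) k =>
      ((f k * √(w k).toReal : ℝ) : ℂ) * ω.2.2.2.2.1 k + ((1 : ℝ) : ℂ) * ω.2.2.2.2.2 k)
      (sampleLaw M K S.noiseVar η) :=
    indepFun_comp_x S.noiseVar η measurable_id hN.measurable fun _ => rfl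
  have := mutualInfo_gaussian_channel (fun k => (f k : ℝ)) (p := fun _ => 1)
    (fun _ => by positivity) (measurePreserving_sample_x S.noiseVar η) hN hind
  rw [← this]
  refine mutualInfo_congr (Filter.EventuallyEq.refl _ _) (ae_of_all _ fun ω => ?_)
  ext k
  simp only [hf, activeFading]
  split_ifs
  · simp
  · push_cast
    ring

/-- Now the input `x` is Gaussian and the effective noise `f · zfNoise + u` is known only through
its power, which equals that of its Gaussian counterpart. -/
lemma le_mutualInfo_x_z
    (hu : ∀ᵐ h ∂η, IsUnit (((Matrix.of h).conjTranspose * Matrix.of h).det))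
    (hw : ∀ᵐ h ∂η, S.noiseLevel h = w) :
    ENNReal.ofReal (∑ k, sourceRate (w k) (φ w k))
      ≤ mutualInfo S.canonical.x (S.canonical.z φ) (sampleLaw M K S.noiseVar η) := by
  rw [mutualInfo_congr (Filter.EventuallyEq.refl _ S.canonical.x)
    (S.canonical_z_ae_eq η φ hu hw)]
  simp_rw [sourceRate_eq]
  set f : Fin K → ℝ≥0 := fun k => activeFading (w k) (φ w k) with hf
  have hZ : (fun (ω : Sample M K) k => ((φ w k : ℝ) : ℂ)
      * (if w k = ∞ then 0 else ω.1 k + S.zfNoise w k ω) + ω.2.2.2.2.2 k)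
      = fun ω k => ((f k : ℝ) : ℂ) * ω.1 k + (((f k : ℝ) : ℂ) * S.zfNoise w k ω
        + ω.2.2.2.2.2 k) := by
    ext ω k
    simp only [hf, activeFading]
    split_ifs
    · simp
    · ring
  rw [hZ]
  have hzm := S.measurable_zfNoise w
  have hDm : ∀ k, MemLp (fun ω : Sample M K => ((f k : ℝ) : ℂ) * S.zfNoise w k ω
      + ω.2.2.2.2.2 k) 2 (sampleLaw M K S.noiseVar η) ∧
      ∫ ω : Sample M K, ‖((f k : ℝ) : ℂ) * S.zfNoise w k ω + ω.2.2.2.2.2 k‖ ^ 2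
        ∂(sampleLaw M K S.noiseVar η) = (f k ^ 2 * (w k).toNNReal + 1 : ℝ≥0) := by
    intro k
    obtain ⟨h1, h2, h3⟩ := S.moments_u η k
    obtain ⟨h4, h5⟩ := S.moments_zfNoise η hu hw k
    have hind : IndepFun (S.zfNoise w k) (fun ω : Sample M K => ω.2.2.2.2.2 k)
        (sampleLaw M K S.noiseVar η) :=
      indepFun_comp_u S.noiseVar η (hzm k) (measurable_pi_apply k) fun _ => rfl
    have := moments_channel (f k : ℝ) h4 h5 h1 h2 h3 hind
    refine ⟨this.1, this.2.trans ?_⟩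
    push_cast
    rw [ENNReal.toReal]
    ring
  have hZm : ∀ k, MemLp (fun ω : Sample M K => ((f k : ℝ) : ℂ) * ω.1 k
      + (((f k : ℝ) : ℂ) * S.zfNoise w k ω + ω.2.2.2.2.2 k)) 2 (sampleLaw M K S.noiseVar η) ∧
      ∫ ω : Sample M K, ‖((f k : ℝ) : ℂ) * ω.1 k
        + (((f k : ℝ) : ℂ) * S.zfNoise w k ω + ω.2.2.2.2.2 k)‖ ^ 2
        ∂(sampleLaw M K S.noiseVar η)
        = ((f k ^ 2 * (w k).toNNReal + 1 : ℝ≥0) : ℝ) + (f k : ℝ) ^ 2 * (1 : ℝ≥0) := by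
    intro k
    obtain ⟨h1, h2, h3⟩ := S.moments_x η k
    have h6 : MemLp (fun ω : Sample M K => ((f k : ℝ) : ℂ) * ω.1 k) 2
        (sampleLaw M K S.noiseVar η) := h1.const_mul _
    refine ⟨h6.add (hDm k).1, ?_⟩
    have hind : IndepFun (fun ω : Sample M K => ((f k : ℝ) : ℂ) * ω.1 k)
        (fun ω => ((f k : ℝ) : ℂ) * S.zfNoise w k ω + ω.2.2.2.2.2 k)
        (sampleLaw M K S.noiseVar η) :=
      indepFun_comp_x S.noiseVar η ((measurable_pi_apply k).const_mul _)
        (((hzm k).const_mul _).add (by fun_prop)) fun _ => rfl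
    rw [integral_norm_sq_add h6 (hDm k).1 hind (by rw [integral_const_mul, h2, mul_zero]),
      (hDm k).2]
    simp_rw [norm_mul, mul_pow]
    rw [integral_const_mul, h3, add_comm]
    simp
  refine le_of_eq_of_le ?_ (le_mutualInfo_of_gaussian_input (sampleLaw M K S.noiseVar η)
    (X := fun ω => ω.1) measurable_fst (measurable_pi_lambda _ fun k => ?_) (fun k => (f k : ℝ))
    (t := fun k => f k ^ 2 * (w k).toNNReal + 1)
    (s := fun k => (f k ^ 2 * (w k).toNNReal + 1) + f k ^ 2 * 1) (p := fun _ => 1)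
    (fun k => by positivity) (fun k => by push_cast; rfl)
    (measurePreserving_sample_x S.noiseVar η).map_eq ?_ (fun k => (hZm k).1) ?_ ?_)
  · rfl
  · have := hzm k
    fun_prop
  · intro k
    simpa using (hDm k).1
  · intro k
    simpa using (hDm k).2
  · intro k
    rw [(hZm k).2]
    push_cast
    rfl

end Scheme

end QCI

namespace QCI

/-! ### Concavity of the rate trade-off and reverse water-filling. -/

section WaterFilling

/-- The rate that reverse water-filling with level `ν` allocates to a component of noise level
`w`. -/
noncomputable def allocatedRate (ν : ℝ) (w : ℝ≥0∞) : ℝ := max (Real.logb 2 (1 / w.toReal / ν)) 0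

/-- The rate conveyed about a component of noise level `w` by its water-filling allocation. -/
noncomputable def conveyedRate (ν : ℝ) (w : ℝ≥0∞) : ℝ :=
  Real.logb 2 (1 + 1 / w.toReal) - Real.logb 2 (1 + 1 / w.toReal * 2 ^ (-allocatedRate ν w))

/-- The fading of a component of noise level `w` that realizes its water-filling allocation. -/
noncomputable def allocatedFading (ν : ℝ) (w : ℝ≥0∞) : ℝ≥0 :=
  (√((2 ^ allocatedRate ν w - 1) / (1 + w.toReal))).toNNReal

lemma allocatedRate_nonneg (ν : ℝ) (w : ℝ≥0∞) : 0 ≤ allocatedRate ν w := le_max_right _ _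

/-- Rests on the default values `ENNReal.toReal ∞ = 0`, `1 / 0 = 0` and `Real.logb 2 0 = 0`. -/
lemma allocatedRate_top (ν : ℝ) : allocatedRate ν ∞ = 0 := by simp [allocatedRate]

lemma conveyedRate_top (ν : ℝ) : conveyedRate ν ∞ = 0 := by simp [conveyedRate]

/-- The tangent inequality for the convex function `t ↦ log (1 + exp t)` at `t = log r`. It is
obtained from concavity of `log`, as `(1 + y) / (1 + r)` is a convex combination of `1` and `y / r`.
-/
lemma log_one_add_sub_le {r y : ℝ} (hr : 0 < r) (hy : 0 < y) :
    Real.log (1 + r) - Real.log (1 + y) ≤ r / (1 + r) * (Real.log r - Real.log y) := by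
  have h := strictConcaveOn_log_Ioi.concaveOn.2 (Set.mem_Ioi.2 one_pos)
    (Set.mem_Ioi.2 (div_pos hy hr)) (by positivity : 0 ≤ 1 / (1 + r))
    (by positivity : 0 ≤ r / (1 + r)) (by field_simp)
  have e : (1 / (1 + r)) • (1 : ℝ) + (r / (1 + r)) • (y / r) = (1 + y) / (1 + r) := by
    simp only [smul_eq_mul]; field_simp
  rw [e, Real.log_div hy.ne' hr.ne',
    Real.log_div (by positivity : 1 + y ≠ 0) (by positivity : 1 + r ≠ 0)] at h
  simp only [smul_eq_mul, Real.log_one, mul_zero, zero_add] at h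
  linarith

/-- Eliminates the fading: the rate conveyed depends on it only through the rate spent, since `2 ^
(-r) = 1 / (1 + f² (1 + w))`. -/
lemma sourceRate_eq_sub {w : ℝ≥0∞} (hw0 : w ≠ 0) (hw : w ≠ ∞) (f : ℝ≥0) :
    sourceRate w f = Real.logb 2 (1 + 1 / w.toReal)
      - Real.logb 2 (1 + 1 / w.toReal * 2 ^ (-relayRate w f)) := by
  have hpos : 0 < w.toReal := ENNReal.toReal_pos hw0 hw
  rw [sourceRate, relayRate, if_neg hw, if_neg hw]
  have hs : 0 < 1 + (f : ℝ) ^ 2 * (1 + w.toReal) := by positivity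
  rw [Real.rpow_neg two_pos.le, Real.rpow_logb two_pos (by norm_num) hs,
    ← Real.logb_div (by positivity) (by positivity)]
  congr 1
  have h2 : 0 < 1 + (f : ℝ) ^ 2 * w.toReal := by positivity
  field_simp
  ring

/-- The rate conveyed is concave in the rate spent, with the slope `ν / (1 + ν)` at the
water-filling allocation. -/
lemma sourceRate_le {ν : ℝ} (hν : 0 < ν) {w : ℝ≥0∞} (hw0 : w ≠ 0) (f : ℝ≥0) :
    sourceRate w f
      ≤ conveyedRate ν w + ν / (1 + ν) * (relayRate w f - allocatedRate ν w) := by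
  by_cases hw : w = ∞
  · rw [hw, conveyedRate_top, allocatedRate_top]
    simp [sourceRate, relayRate]
  have hpos : 0 < w.toReal := ENNReal.toReal_pos hw0 hw
  have hr := relayRate_nonneg w f
  rw [sourceRate_eq_sub hw0 hw, conveyedRate]
  generalize relayRate w f = r at hr
  have hρ : 0 < 1 / w.toReal := by positivity
  have hc : allocatedRate ν w = max (Real.logb 2 (1 / w.toReal / ν)) 0 := rfl
  have hc0 := allocatedRate_nonneg ν w
  generalize allocatedRate ν w = c at hc hc0
  generalize 1 / w.toReal = ρ at hρ hc
  have hlog2 : 0 < Real.log 2 := Real.log_pos one_lt_two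
  have hpow : ∀ t : ℝ, 0 < ρ * 2 ^ (-t) := fun t => by positivity
  have hlogpow : ∀ t : ℝ, Real.log (ρ * 2 ^ (-t)) = Real.log ρ - t * Real.log 2 := fun t => by
    rw [Real.log_mul hρ.ne' (by positivity), Real.log_rpow two_pos]
    ring
  have key := log_one_add_sub_le (hpow c) (hpow r)
  rw [hlogpow, hlogpow] at key
  -- Complementary slackness: a positive allocation has `ρ 2^(-c) = ν`, hence exactly the slope `ν /
  -- (1 + ν)`; at a zero allocation `ρ ≤ ν` makes the slope at most that, and `r - c = r ≥ 0`.
  have hslope : ρ * 2 ^ (-c) / (1 + ρ * 2 ^ (-c)) * ((r - c) * Real.log 2)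
      ≤ ν / (1 + ν) * ((r - c) * Real.log 2) := by
    rcases le_total (Real.logb 2 (ρ / ν)) 0 with h | h
    · rw [max_eq_right h] at hc
      subst hc
      simp only [neg_zero, Real.rpow_zero, mul_one, sub_zero]
      refine mul_le_mul_of_nonneg_right ?_ (by positivity)
      have h1 : ρ / ν ≤ 1 := by
        rwa [Real.logb_nonpos_iff one_lt_two (by positivity)] at h
      rw [div_le_one hν] at h1
      rw [div_le_div_iff₀ (by positivity) (by positivity)]
      nlinarith
    · rw [max_eq_left h] at hc
      have h1 : ρ * 2 ^ (-c) = ν := by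
        rw [hc, Real.rpow_neg two_pos.le, Real.rpow_logb two_pos (by norm_num) (by positivity)]
        field_simp
      rw [h1]
  have h3 : Real.log (1 + ρ * 2 ^ (-c)) - Real.log (1 + ρ * 2 ^ (-r))
      ≤ ν / (1 + ν) * (r - c) * Real.log 2 := by
    have e : Real.log ρ - c * Real.log 2 - (Real.log ρ - r * Real.log 2)
        = (r - c) * Real.log 2 := by ring
    rw [e] at key
    linarith
  have h4 : Real.logb 2 (1 + ρ * 2 ^ (-c)) - Real.logb 2 (1 + ρ * 2 ^ (-r))
      ≤ ν / (1 + ν) * (r - c) := by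
    rw [Real.logb, Real.logb, ← sub_div, div_le_iff₀ hlog2]
    exact h3
  linarith

/-- The fading is the solution `f` of `1 + f² (1 + w) = 2 ^ allocatedRate ν w`. -/
lemma relayRate_allocatedFading (ν : ℝ) (w : ℝ≥0∞) :
    relayRate w (allocatedFading ν w) = allocatedRate ν w := by
  by_cases hw : w = ∞
  · rw [hw, allocatedRate_top, relayRate, if_pos rfl]
  have h1 : (1 : ℝ) ≤ 2 ^ allocatedRate ν w :=
    Real.one_le_rpow one_le_two (allocatedRate_nonneg ν w)
  have h2 : (0 : ℝ) < 1 + w.toReal := by positivity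
  rw [relayRate, if_neg hw, allocatedFading, Real.coe_toNNReal _ (Real.sqrt_nonneg _),
    Real.sq_sqrt (div_nonneg (by linarith) h2.le), div_mul_cancel₀ _ h2.ne', add_sub_cancel,
    Real.logb_rpow two_pos (by norm_num)]

lemma sourceRate_allocatedFading (ν : ℝ) {w : ℝ≥0∞} (hw0 : w ≠ 0) :
    sourceRate w (allocatedFading ν w) = conveyedRate ν w := by
  by_cases hw : w = ∞
  · rw [hw, conveyedRate_top, sourceRate, if_pos rfl]
  rw [sourceRate_eq_sub hw0 hw, relayRate_allocatedFading, conveyedRate]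

end WaterFilling

/-! ### Averaging over the quantized noise levels. -/

namespace Scheme

variable {Ω : Type*} [MeasurableSpace Ω] {μ : Measure Ω} {M K m : ℕ} (S : Scheme μ M K m)

/-- The possible values of the quantized noise levels. -/
noncomputable def levels : Finset (Fin K → ℝ≥0∞) :=
  Fintype.piFinset fun _ : Fin K => Finset.univ.image S.b

/-- The channel matrices with quantized noise levels `w`. -/
def levelSet (w : Fin K → ℝ≥0∞) : Set (Fin M → Fin K → ℂ) := S.noiseLevel ⁻¹' {w}

lemma measurableSet_levelSet (w : Fin K → ℝ≥0∞) : MeasurableSet (S.levelSet w) :=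
  S.measurable_noiseLevel (measurableSet_singleton w)

lemma levelSet_eq_empty {w : Fin K → ℝ≥0∞} (hw : w ∉ S.levels) : S.levelSet w = ∅ := by
  ext h
  simp only [levelSet, Set.mem_preimage, Set.mem_singleton_iff, Set.mem_empty_iff_false, iff_false]
  rintro rfl
  exact hw (S.noiseLevel_mem h)

lemma ne_zero_of_mem_levels {w : Fin K → ℝ≥0∞} (hw : w ∈ S.levels) (k : Fin K) : w k ≠ 0 := by
  obtain ⟨j, _, hj⟩ := Finset.mem_image.1 (Fintype.mem_piFinset.1 hw k)
  rw [← hj]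
  exact (S.b_pos j).ne'

/-- The mean of a function of the quantized noise levels. -/
noncomputable def levelMean (g : (Fin K → ℝ≥0∞) → ℝ) : ℝ :=
  ∑ w ∈ S.levels, (rayleigh M K).real (S.levelSet w) * g w

lemma condMutualInfo_canonical {α β : Type*} [MeasurableSpace α] [MeasurableSpace β]
    (X : Sample M K → α) (Y : Sample M K → β) :
    condMutualInfo X Y S.canonical.A1' (sampleLaw M K S.noiseVar (rayleigh M K))
      = ∑ w ∈ S.levels, rayleigh M K (S.levelSet w) * mutualInfo X Y
        (sampleLaw M K S.noiseVar (ProbabilityTheory.cond (rayleigh M K) (S.levelSet w))) := by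
  have hset : ∀ w, S.canonical.A1' ⁻¹' {w}
      = (fun ω : Sample M K => ω.2.2.1) ⁻¹' (S.levelSet w) := by
    intro w
    have : S.canonical.A1' = fun ω => S.noiseLevel ω.2.2.1 := funext fun ω => S.canonical.A1'_eq ω
    rw [this]
    rfl
  have hq : ∀ w, sampleLaw M K S.noiseVar (rayleigh M K) (S.canonical.A1' ⁻¹' {w})
      = rayleigh M K (S.levelSet w) := fun w => by
    rw [hset]
    exact (measurePreserving_sample_H S.noiseVar _).measure_preimage
      (S.measurableSet_levelSet w).nullMeasurableSet
  rw [condMutualInfo, tsum_eq_sum (s := S.levels)]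
  · refine Finset.sum_congr rfl fun w _ => ?_
    rw [hq, hset, cond_sampleLaw]
  · intro w hw
    rw [hq, S.levelSet_eq_empty hw, measure_empty, zero_mul]

lemma hasLaw_sample :
    HasLaw S.sample (sampleLaw M K S.noiseVar (rayleigh M K)) μ := S.hasLaw

lemma measurableSet_canonical_A1' (w : Fin K → ℝ≥0∞) :
    MeasurableSet (S.canonical.A1' ⁻¹' {w}) :=
  S.measurable_canonical_A1' (measurableSet_singleton w)

/-- Informations depend only on the joint law, so they are computed on the sample space, where the
variables are measurable and conditioning on the levels affects only `H`. -/
lemma condMutualInfo_eq_sum {α β : Type*} [MeasurableSpace α] [MeasurableSpace β]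
    {X : Sample M K → α} {Y : Sample M K → β} (hX : Measurable X) (hY : Measurable Y) :
    condMutualInfo (fun ω => X (S.sample ω)) (fun ω => Y (S.sample ω)) S.A1' μ
      = ∑ w ∈ S.levels, rayleigh M K (S.levelSet w) * mutualInfo X Y
        (sampleLaw M K S.noiseVar (ProbabilityTheory.cond (rayleigh M K) (S.levelSet w))) := by
  rw [← S.condMutualInfo_canonical X Y]
  have h := condMutualInfo_comp S.hasLaw_sample.aemeasurable hX hY S.measurableSet_canonical_A1'
  rw [S.hasLaw_sample.map_eq] at h
  exact h

lemma isProbabilityMeasure_cond_levelSet {w : Fin K → ℝ≥0∞}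
    (hw : rayleigh M K (S.levelSet w) ≠ 0) :
    IsProbabilityMeasure (ProbabilityTheory.cond (rayleigh M K) (S.levelSet w)) :=
  cond_isProbabilityMeasure hw

lemma ae_cond_noiseLevel (w : Fin K → ℝ≥0∞) :
    ∀ᵐ h ∂(ProbabilityTheory.cond (rayleigh M K) (S.levelSet w)), S.noiseLevel h = w :=
  ae_cond_mem (S.measurableSet_levelSet w)

lemma ae_cond_isUnit (hKM : K ≤ M) (w : Fin K → ℝ≥0∞) :
    ∀ᵐ h ∂(ProbabilityTheory.cond (rayleigh M K) (S.levelSet w)),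
      IsUnit (((Matrix.of h).conjTranspose * Matrix.of h).det) :=
  cond_absolutelyContinuous.ae_le (ae_isUnit_det_gram hKM)

lemma ofReal_levelMean {g : (Fin K → ℝ≥0∞) → ℝ} (hg : ∀ w, 0 ≤ g w) :
    ENNReal.ofReal (S.levelMean g)
      = ∑ w ∈ S.levels, rayleigh M K (S.levelSet w) * ENNReal.ofReal (g w) := by
  rw [levelMean, ENNReal.ofReal_sum_of_nonneg fun w _ => mul_nonneg measureReal_nonneg (hg w)]
  refine Finset.sum_congr rfl fun w _ => ?_
  rw [ENNReal.ofReal_mul measureReal_nonneg, ofReal_measureReal]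

variable (φ : (Fin K → ℝ≥0∞) → Fin K → ℝ≥0)

lemma condMutualInfo_xHat_z_le (hKM : K ≤ M) :
    condMutualInfo S.xHat (S.z φ) S.A1' μ
      ≤ ENNReal.ofReal (S.levelMean fun w => ∑ k, relayRate (w k) (φ w k)) := by
  rw [S.ofReal_levelMean fun w => Finset.sum_nonneg fun k _ => relayRate_nonneg _ _]
  refine (S.condMutualInfo_eq_sum S.measurable_canonical_xHat
    (S.measurable_canonical_z φ)).trans_le (Finset.sum_le_sum fun w _ => ?_)
  -- On a null level set the conditional law is not a probability measure, but its weight is zero.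
  by_cases hw : rayleigh M K (S.levelSet w) = 0
  · simp [hw]
  have := S.isProbabilityMeasure_cond_levelSet hw
  gcongr
  exact S.mutualInfo_xHat_z_le _ φ (S.ae_cond_isUnit hKM w) (S.ae_cond_noiseLevel w)

lemma condMutualInfo_xHatG_zHatG :
    condMutualInfo S.xHatG (S.zHatG φ) S.A1' μ
      = ENNReal.ofReal (S.levelMean fun w => ∑ k, relayRate (w k) (φ w k)) := by
  rw [S.ofReal_levelMean fun w => Finset.sum_nonneg fun k _ => relayRate_nonneg _ _]
  refine (S.condMutualInfo_eq_sum S.measurable_canonical_xHatG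
    (S.measurable_canonical_zHatG φ)).trans (Finset.sum_congr rfl fun w _ => ?_)
  by_cases hw : rayleigh M K (S.levelSet w) = 0
  · simp [hw]
  have := S.isProbabilityMeasure_cond_levelSet hw
  rw [S.mutualInfo_xHatG_zHatG _ φ (S.ae_cond_noiseLevel w)]

lemma condMutualInfo_x_zHatG :
    condMutualInfo S.x (S.zHatG φ) S.A1' μ
      = ENNReal.ofReal (S.levelMean fun w => ∑ k, sourceRate (w k) (φ w k)) := by
  rw [S.ofReal_levelMean fun w => Finset.sum_nonneg fun k _ => sourceRate_nonneg _ _]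
  refine (S.condMutualInfo_eq_sum (X := S.canonical.x) measurable_fst
    (S.measurable_canonical_zHatG φ)).trans (Finset.sum_congr rfl fun w _ => ?_)
  by_cases hw : rayleigh M K (S.levelSet w) = 0
  · simp [hw]
  have := S.isProbabilityMeasure_cond_levelSet hw
  rw [S.mutualInfo_x_zHatG _ φ (S.ae_cond_noiseLevel w)]

lemma le_condMutualInfo_x_z (hKM : K ≤ M) :
    ENNReal.ofReal (S.levelMean fun w => ∑ k, sourceRate (w k) (φ w k))
      ≤ condMutualInfo S.x (S.z φ) S.A1' μ := by
  rw [S.ofReal_levelMean fun w => Finset.sum_nonneg fun k _ => sourceRate_nonneg _ _]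
  refine le_of_le_of_eq (Finset.sum_le_sum fun w _ => ?_)
    (S.condMutualInfo_eq_sum (X := S.canonical.x) measurable_fst (S.measurable_canonical_z φ)).symm
  by_cases hw : rayleigh M K (S.levelSet w) = 0
  · simp [hw]
  have := S.isProbabilityMeasure_cond_levelSet hw
  gcongr
  exact S.le_mutualInfo_x_z _ φ (S.ae_cond_isUnit hKM w) (S.ae_cond_noiseLevel w)

/-! ### From joint noise levels to the probabilities `P_j`. -/

section LevelProbabilities

lemma hasLaw_H : HasLaw S.H (rayleigh M K) μ := by
  refine ⟨(by fun_prop : Measurable fun ω : Sample M K => ω.2.2.1).comp_aemeasurable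
    S.hasLaw_sample.aemeasurable, ?_⟩
  have h := (measurePreserving_sample_H S.noiseVar (rayleigh M K)).map_eq
  rw [← S.hasLaw_sample.map_eq, AEMeasurable.map_map_of_aemeasurable (by fun_prop)
    S.hasLaw_sample.aemeasurable] at h
  exact h

lemma P_eq_rayleigh (k : Fin K) (j : Fin (m + 1)) :
    S.P k j = (rayleigh M K).real {h | S.noiseVar * zfError h k ∈ cell S.b j} := by
  have hm : MeasurableSet {h : Fin M → Fin K → ℂ | S.noiseVar * zfError h k ∈ cell S.b j} :=
    (measurableSet_cell S.b j).preimage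
      (by fun_prop : Measurable fun h : Fin M → Fin K → ℂ => S.noiseVar * zfError h k)
  rw [← S.hasLaw_H.measureReal_eq hm, P]
  congr 1
  ext ω
  simp [a_eq]

lemma P_eq (k l : Fin K) (j : Fin (m + 1)) : S.P k j = S.P l j := by
  have hm : ∀ k : Fin K, S.P k j = ((rayleigh M K).map fun h => zfError h k).real
      {r | S.noiseVar * r ∈ cell S.b j} := fun k => by
    rw [P_eq_rayleigh, map_measureReal_apply (s := {r : ℝ | S.noiseVar * r ∈ cell S.b j}) (by fun_prop)
      ((measurableSet_cell S.b j).preimage (by fun_prop : Measurable fun r : ℝ => S.noiseVar * r))]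
    rfl
  rw [hm, hm, rayleigh_map_zfError k l]

lemma levelMean_eq_integral (g : (Fin K → ℝ≥0∞) → ℝ) :
    S.levelMean g = ∫ h, g (S.noiseLevel h) ∂(rayleigh M K) := by
  have h1 : ∀ h, g (S.noiseLevel h) = ∑ w ∈ S.levels, (S.levelSet w).indicator (fun _ => g w) h := by
    intro h
    rw [Finset.sum_eq_single_of_mem (s := S.levels) (S.noiseLevel h) (S.noiseLevel_mem h)]
    · rw [Set.indicator_of_mem (show h ∈ S.levelSet (S.noiseLevel h) from rfl)]
    · intro w _ hw
      have hh : h ∉ S.levelSet w := fun hh => hw (show S.noiseLevel h = w from hh).symm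
      rw [Set.indicator_of_notMem hh]
  simp_rw [h1]
  rw [integral_finsetSum _ fun w _ => (integrable_const _).indicator (S.measurableSet_levelSet w),
    levelMean]
  refine Finset.sum_congr rfl fun w _ => ?_
  rw [integral_indicator_const _ (S.measurableSet_levelSet w), smul_eq_mul]

/-- The cells partition the line. Repeated grid points are harmless: only the first of them has a
non-empty cell. -/
lemma integral_ceilGrid (g : ℝ≥0∞ → ℝ) (k : Fin K) :
    ∫ h, g (S.noiseLevel h k) ∂(rayleigh M K) = ∑ j, S.P k j * g (S.b j) := by
  have hm : ∀ j, MeasurableSet {h : Fin M → Fin K → ℂ | S.noiseVar * zfError h k ∈ cell S.b j} :=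
    fun j => (measurableSet_cell S.b j).preimage
      (by fun_prop : Measurable fun h : Fin M → Fin K → ℂ => S.noiseVar * zfError h k)
  have h1 : ∀ h, g (S.noiseLevel h k) = ∑ j,
      {h : Fin M → Fin K → ℂ | S.noiseVar * zfError h k ∈ cell S.b j}.indicator
        (fun _ => g (S.b j)) h := by
    intro h
    obtain ⟨j, hj⟩ := exists_mem_cell S.b S.exists_b_eq_top (S.noiseVar * zfError h k)
    rw [Finset.sum_eq_single_of_mem j (Finset.mem_univ j)]
    · rw [Set.indicator_of_mem (by exact hj), noiseLevel, ceilGrid_eq_of_mem_cell S.b S.b_mono hj]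
    · intro i _ hij
      refine Set.indicator_of_notMem (fun hi => ?_) _
      rcases lt_or_gt_of_ne hij with h' | h'
      · exact cell_disjoint S.b h' hi hj
      · exact cell_disjoint S.b h' hj hi
  simp_rw [h1]
  rw [integral_finsetSum _ fun j _ => (integrable_const _).indicator (hm j)]
  refine Finset.sum_congr rfl fun j _ => ?_
  rw [integral_indicator_const _ (hm j), smul_eq_mul, P_eq_rayleigh]

/-- The mean of a sum over the components of a function that vanishes for erased components. -/
lemma levelMean_sum (g : ℝ≥0∞ → ℝ) (hg : g ∞ = 0) (k : Fin K) :
    S.levelMean (fun w => ∑ l, g (w l))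
      = ∑ j : Fin m, K * S.P k j.castSucc * g (S.b j.castSucc) := by
  have hm : ∀ l, Integrable (fun h => g (S.noiseLevel h l)) (rayleigh M K) := fun l => by
    refine Integrable.of_bound
      (S.measurable_comp_noiseLevel fun w => g (w l)).aestronglyMeasurable
      (∑ j, |g (S.b j)|) (ae_of_all _ fun h => ?_)
    obtain ⟨j, hj⟩ := ceilGrid_mem_range S.b S.exists_b_eq_top (S.noiseVar * zfError h l)
    rw [noiseLevel, ← hj, Real.norm_eq_abs]
    exact Finset.single_le_sum (f := fun j => |g (S.b j)|) (fun _ _ => abs_nonneg _)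
      (Finset.mem_univ j)
  rw [levelMean_eq_integral, integral_finsetSum _ fun l _ => hm l]
  -- All components share the probabilities of component `k`, whence the factor `K`; the last grid
  -- point is `∞`, where `g` vanishes, so `m` terms remain.
  simp_rw [S.integral_ceilGrid g, S.P_eq _ k]
  rw [Finset.sum_const, Finset.card_univ, Fintype.card_fin, nsmul_eq_mul, Fin.sum_univ_castSucc,
    (S.b_eq_top_iff (Fin.last m)).2 rfl, hg, mul_zero, add_zero, Finset.mul_sum]
  exact Finset.sum_congr rfl fun j _ => by ring

end LevelProbabilities

/-! ### Lagrangian bound and its attainment. -/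

section Optimization

variable {S} {k : Fin K} {C ν : ℝ}

lemma levelMean_mono {g g' : (Fin K → ℝ≥0∞) → ℝ} (h : ∀ w ∈ S.levels, g w ≤ g' w) :
    S.levelMean g ≤ S.levelMean g' :=
  Finset.sum_le_sum fun w hw => mul_le_mul_of_nonneg_left (h w hw) measureReal_nonneg

/-- The slope `ν / (1 + ν)` is common to all components and levels, so it acts as the Lagrange
multiplier of the averaged rate constraint. -/
lemma levelMean_sourceRate_le (hν : 0 < ν) :
    S.levelMean (fun w => ∑ l, sourceRate (w l) (φ w l))
      ≤ S.levelMean (fun w => ∑ l, conveyedRate ν (w l))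
        + ν / (1 + ν) * (S.levelMean (fun w => ∑ l, relayRate (w l) (φ w l))
          - S.levelMean (fun w => ∑ l, allocatedRate ν (w l))) := by
  have h : S.levelMean (fun w => ∑ l, sourceRate (w l) (φ w l))
      ≤ S.levelMean (fun w => ∑ l, conveyedRate ν (w l)
        + ν / (1 + ν) * (∑ l, relayRate (w l) (φ w l) - ∑ l, allocatedRate ν (w l))) := by
    refine levelMean_mono fun w hw => ?_
    rw [← Finset.sum_sub_distrib, Finset.mul_sum, ← Finset.sum_add_distrib]
    exact Finset.sum_le_sum fun l _ => sourceRate_le hν (S.ne_zero_of_mem_levels hw l) _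
  refine h.trans_eq ?_
  simp only [levelMean]
  rw [← Finset.sum_sub_distrib, Finset.mul_sum, ← Finset.sum_add_distrib]
  exact Finset.sum_congr rfl fun w _ => by ring

lemma levelMean_allocatedRate
    (h : ∑ j : Fin m, K * S.P k j.castSucc * S.c ν j.castSucc = C - K * S.H0 k) :
    S.levelMean (fun w => ∑ l, allocatedRate ν (w l)) = C - K * S.H0 k := by
  rw [S.levelMean_sum _ (allocatedRate_top ν) k, ← h]
  rfl

lemma levelMean_conveyedRate (k : Fin K) (ν : ℝ) :
    S.levelMean (fun w => ∑ l, conveyedRate ν (w l)) = S.Rlb2 k ν := by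
  rw [S.levelMean_sum _ (conveyedRate_top ν) k]
  rfl

lemma condMutualInfo_x_zHatG_le_of_feasible (hν : 0 < ν)
    (h : ∑ j : Fin m, K * S.P k j.castSucc * S.c ν j.castSucc = C - K * S.H0 k)
    (hφ : S.Feasible k C φ) :
    condMutualInfo S.x (S.zHatG φ) S.A1' μ ≤ ENNReal.ofReal (S.Rlb2 k ν) := by
  have hC := levelMean_allocatedRate h
  -- The budget is a mean of non-negative allocations, so `ENNReal.ofReal` does not truncate it and
  -- the constraint is a real inequality.
  have hC0 : 0 ≤ C - K * S.H0 k := by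
    rw [← hC]
    exact Finset.sum_nonneg fun w _ => mul_nonneg measureReal_nonneg
      (Finset.sum_nonneg fun l _ => allocatedRate_nonneg _ _)
  rw [Feasible, condMutualInfo_xHatG_zHatG, ENNReal.ofReal_le_ofReal_iff hC0] at hφ
  rw [condMutualInfo_x_zHatG]
  refine ENNReal.ofReal_le_ofReal ((levelMean_sourceRate_le φ hν).trans ?_)
  rw [levelMean_conveyedRate k ν, hC]
  have : ν / (1 + ν) * (S.levelMean (fun w => ∑ l, relayRate (w l) (φ w l)) - (C - K * S.H0 k)) ≤ 0 :=
    mul_nonpos_of_nonneg_of_nonpos (by positivity) (by linarith)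
  linarith

lemma feasible_allocatedFading
    (h : ∑ j : Fin m, K * S.P k j.castSucc * S.c ν j.castSucc = C - K * S.H0 k) :
    S.Feasible k C fun w l => allocatedFading ν (w l) := by
  rw [Feasible, condMutualInfo_xHatG_zHatG]
  simp_rw [relayRate_allocatedFading]
  rw [levelMean_allocatedRate h]

variable (S) in
lemma condMutualInfo_x_zHatG_allocatedFading (k : Fin K) (ν : ℝ) :
    condMutualInfo S.x (S.zHatG fun w l => allocatedFading ν (w l)) S.A1' μ
      = ENNReal.ofReal (S.Rlb2 k ν) := by
  rw [condMutualInfo_x_zHatG, ← levelMean_conveyedRate]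
  congr 1
  exact Finset.sum_congr rfl fun w hw => congrArg _ <| Finset.sum_congr rfl fun l _ =>
    sourceRate_allocatedFading ν (S.ne_zero_of_mem_levels hw l)

end Optimization

end Scheme

end QCI

theorem lemma4 {Ω : Type*} [MeasurableSpace Ω] (μ : Measure Ω) [IsProbabilityMeasure μ]
    (M K m : ℕ) (hKM : K ≤ M) (S : QCI.Scheme μ M K m) :
    -- the two inequalities, for every non-negative diagonal fading matrix `Φ` that depends on `A₁'`
    (∀ φ : (Fin K → ℝ≥0∞) → Fin K → ℝ≥0,
      QCI.condMutualInfo S.xHat (S.z φ) S.A1' μ ≤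
          QCI.condMutualInfo S.xHatG (S.zHatG φ) S.A1' μ ∧
        QCI.condMutualInfo S.x (S.zHatG φ) S.A1' μ ≤
          QCI.condMutualInfo S.x (S.z φ) S.A1' μ) ∧
    -- the rates, for every optimal `Φ`; `k` is any of the identically distributed noise levels
    ∀ (k : Fin K) (C ν : ℝ), 0 < ν →
      (∑ j : Fin m, K * S.P k j.castSucc * S.c ν j.castSucc = C - K * S.H0 k) →
      (∃ φ, S.Optimal k C φ) ∧
      ∀ φ, S.Optimal k C φ →
        QCI.condMutualInfo S.xHatG (S.zHatG φ) S.A1' μ ≤ ENNReal.ofReal (C - K * S.H0 k) ∧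
        QCI.condMutualInfo S.xHat (S.z φ) S.A1' μ ≤ ENNReal.ofReal (C - K * S.H0 k) ∧
        QCI.condMutualInfo S.x (S.zHatG φ) S.A1' μ = ENNReal.ofReal (S.Rlb2 k ν) ∧
        ENNReal.ofReal (S.Rlb2 k ν) ≤ QCI.condMutualInfo S.x (S.z φ) S.A1' μ := by

  refine ⟨fun φ => ⟨?_, ?_⟩, fun k C ν hν h => ⟨?_, fun φ hφ => ?_⟩⟩
  · rw [S.condMutualInfo_xHatG_zHatG φ]
    exact S.condMutualInfo_xHat_z_le φ hKM
  · rw [S.condMutualInfo_x_zHatG φ]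
    exact S.le_condMutualInfo_x_z φ hKM
  -- The maximizer is the water-filling fading, which spends the whole budget.
  · refine ⟨_, QCI.Scheme.feasible_allocatedFading h, fun ψ hψ => ?_⟩
    rw [S.condMutualInfo_x_zHatG_allocatedFading k ν]
    exact QCI.Scheme.condMutualInfo_x_zHatG_le_of_feasible ψ hν h hψ
  -- Any optimal `Φ` does at least as well as the water-filling fading and, being feasible, no
  -- better than the Lagrangian bound.
  · have hrate : QCI.condMutualInfo S.x (S.zHatG φ) S.A1' μ = ENNReal.ofReal (S.Rlb2 k ν) := by
      refine le_antisymm (QCI.Scheme.condMutualInfo_x_zHatG_le_of_feasible φ hν h hφ.1) ?_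
      rw [← S.condMutualInfo_x_zHatG_allocatedFading k ν]
      exact hφ.2 _ (QCI.Scheme.feasible_allocatedFading h)
    refine ⟨hφ.1, ?_, hrate, ?_⟩
    · refine (S.condMutualInfo_xHat_z_le φ hKM).trans ?_
      rw [← S.condMutualInfo_xHatG_zHatG φ]
      exact hφ.1
    · rw [← hrate, S.condMutualInfo_x_zHatG φ]
      exact S.le_condMutualInfo_x_z φ hKM
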